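/- **Setting.** Let $\mathcal S$ be a category with finite products and an object $\Sigma$ all of whose exponentials $\Sigma^X$ exist, where $(\Sigma,\top,\bot,\wedge,\vee)$ is an internal distributive lattice satisfying the Phoa principle $F\sigma = F\bot\vee(\sigma\wedge F\top)$ for $F:\Sigma^\Sigma$ and $\sigma:\Sigma$. We use the typed $\lambda$-notation of $\mathcal S$: a term of type $X$ in context $\Gamma$ is a morphism $\Gamma\to X$. The lattice structure gives the intrinsic order on terms of type $\Sigma$ or $\Sigma^X$, written $\Rightarrow$ on terms of type $\Sigma$. An object $N$ is *overt discrete* if $\Sigma\to\Sigma^N$ has a left adjoint $\exists_N$ for the intrinsic order, and there is $(=_N):N\times N\to\Sigma$ such that $(n=_Nm)=\top$ if and only if $n=m$, for all terms $n,m:N$ in any context. Assume that every overt discrete object $N$ has an object of lists $\mathrm{List}(N)$ (with parametrised primitive recursion at all types, including uniqueness of recursively defined terms), which is again overt discrete; membership $m\in\ell$ and the bounded quantifiers $\exists m\in\ell$, $\forall m\in\ell$ are defined by list recursion. Assume the Scott principle for every overt discrete $N$: $$\Phi\xi \;=\; \exists \ell:\mathrm{List}(N).\ \Phi(\lambda n.\,n\in\ell)\wedge\forall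 n\in\ell.\,\xi n\qquad(\Phi:\Sigma^{\Sigma^N},\ \xi:\Sigma^N).$$ (These hold in every model of abstract Stone duality; it is not required that the adjunction $\Sigma^{(-)}\dashv\Sigma^{(-)}$ be monadic.) **Abstract bases.** An *abstract basis* is an overt discrete object $N$ with $0,1:N$, operations $+,\star:N\times N\to N$ and an open relation $\ll\,:N\times N\to\Sigma$ satisfying, in all contexts, * $0\ll 0$; * $n\ll p$ and $m\ll p$ if and only if $n+m\ll p$; * if $m'\preccurlyeq m\ll n\preccurlyeq n'$ then $m'\ll n'$; * (interpolation) $n\ll m$ if and only if $\exists k.\ n\ll k\ll m$; * ($\star$ rule) if $n\ll m$, $m\ll p$ and $m\ll q$ then $n\ll p\star q$; * (Wilker rule) $n\ll p+q$ if and only if $\exists p'\,q'.\ (n\ll p'+q')\wedge(p'\ll p)\wedge(q'\ll q)$. Here $\preccurlyeq\,:N\times N\to\Sigma$ is the imposed distributive lattice order: the least open relation such that $0\preccurlyeq n\preccurlyeq n\preccurlyeq 1$; $k\star(n+m)\preccurlyeq(k\star n)+(k\star m)$; $\preccurlyeq$ is transitive; $k\preccurlyeq m$ and $k\preccurlyeq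 n$ if and only if $k\preccurlyeq m\star n$; and $n\preccurlyeq k$ and $m\preccurlyeq k$ if and only if $n+m\preccurlyeq k$. (It is part of the notion that this least relation exists.) **Theorem.** Let $(N,0,1,+,\star,\ll)$ be an abstract basis. For $L:\mathrm{List}(\mathrm{List}\,N)$ let $\mathrm{ev}\,L:N$ be the sum (formed with $0$ and $+$), over the members $\ell$ of $L$, of the product (formed with $1$ and $\star$) of the members of $\ell$. For $\Phi:\Sigma^{\Sigma^N}$ let $\mathcal A_L\Phi = \forall\ell\in L.\,\Phi(\lambda m.\,m\in\ell)$. Define $\mathcal E:\Sigma^{\Sigma^N}\to\Sigma^{\Sigma^N}$ by $$\mathcal E\,\Phi\,\xi \;=\; \exists n:N.\ \exists L:\mathrm{List}(\mathrm{List}\,N).\ \xi n\wedge(n\ll\mathrm{ev}\,L)\wedge\mathcal A_L\Phi .$$ Then $\mathcal E$ is a nucleus on $\Sigma^N$. That is, writing $X=\Sigma^N$, for every $\mathcal F:\Sigma^{\Sigma^{\Sigma^X}}$, in every context, $$\mathcal E\big(\lambda x.\,\mathcal F(\lambda\phi.\,\phi x)\big)\;=\;\mathcal E\big(\lambda x.\,\mathcal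 F(\lambda\phi.\,\mathcal E\phi x)\big).$$ Moreover, for all $\Phi,\Psi:\Sigma^{\Sigma^N}$, in every context, $$\mathcal E(\Phi\wedge\Psi)=\mathcal E(\mathcal E\Phi\wedge\mathcal E\Psi)\qquad\text{and}\qquad \mathcal E(\Phi\vee\Psi)=\mathcal E(\mathcal E\Phi\vee\mathcal E\Psi).$$ -/

import Mathlib

open CategoryTheory MonoidalCategory CartesianMonoidalCategory

universe v u

namespace ASD

/-!  The ambient calculus is presented by its categorical models.  A term
`Γ ⊢ t : X` of the calculus is a morphism `t : Γ ⟶ X`; the context extension `Γ, x : X` is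
`Γ ⊗ X`, in which the new variable `x` is `snd Γ X` and terms `t` over `Γ` are weakened to
`fst Γ X ≫ t`; an equation of terms in context is an equation of morphisms.  -/

/-- A category with finite products, an object `Sig` (written `Σ`) all of whose exponentials
`pow X = Σ^X` exist, and which is an internal distributive lattice satisfying the Phoa
principle.  The lattice laws are stated for all terms in all contexts. -/
class SierpinskiCategory (C : Type u) [Category.{v} C] [CartesianMonoidalCategory C] where
  /-- the Sierpinski object `Σ` -/
  Sig : C
  /-- the exponential `Σ^X` -/
  pow : C → C
  /-- `λ`-abstraction -/
  curry {Γ X : C} : (Γ ⊗ X ⟶ Sig) ≃ (Γ ⟶ pow X)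
  curry_natural {Δ Γ X : C} (f : Δ ⟶ Γ) (t : Γ ⊗ X ⟶ Sig) :
    curry (f ▷ X ≫ t) = f ≫ curry t
  top : 𝟙_ C ⟶ Sig
  bot : 𝟙_ C ⟶ Sig
  meet : Sig ⊗ Sig ⟶ Sig
  join : Sig ⊗ Sig ⟶ Sig
  meet_comm {Γ : C} (a b : Γ ⟶ Sig) : lift a b ≫ meet = lift b a ≫ meet
  join_comm {Γ : C} (a b : Γ ⟶ Sig) : lift a b ≫ join = lift b a ≫ join
  meet_assoc {Γ : C} (a b c : Γ ⟶ Sig) :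
    lift (lift a b ≫ meet) c ≫ meet = lift a (lift b c ≫ meet) ≫ meet
  join_assoc {Γ : C} (a b c : Γ ⟶ Sig) :
    lift (lift a b ≫ join) c ≫ join = lift a (lift b c ≫ join) ≫ join
  meet_join_absorb {Γ : C} (a b : Γ ⟶ Sig) : lift a (lift a b ≫ join) ≫ meet = a
  join_meet_absorb {Γ : C} (a b : Γ ⟶ Sig) : lift a (lift a b ≫ meet) ≫ join = a
  meet_join_distrib {Γ : C} (a b c : Γ ⟶ Sig) :
    lift a (lift b c ≫ join) ≫ meet = lift (lift a b ≫ meet) (lift a c ≫ meet) ≫ join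
  meet_top {Γ : C} (a : Γ ⟶ Sig) : lift a (toUnit Γ ≫ top) ≫ meet = a
  join_bot {Γ : C} (a : Γ ⟶ Sig) : lift a (toUnit Γ ≫ bot) ≫ join = a
  /-- the Phoa principle `F σ ⇔ F ⊥ ∨ (σ ∧ F ⊤)` for `F : Σ^Σ` and `σ : Σ` -/
  phoa {Γ : C} (F : Γ ⟶ pow Sig) (σ : Γ ⟶ Sig) :
    lift (𝟙 Γ) σ ≫ curry.symm F =
      lift (lift (𝟙 Γ) (toUnit Γ ≫ bot) ≫ curry.symm F)
        (lift σ (lift (𝟙 Γ) (toUnit Γ ≫ top) ≫ curry.symm F) ≫ meet) ≫ join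

section Terms

variable {C : Type u} [Category.{v} C] [CartesianMonoidalCategory C] [SierpinskiCategory C]

variable (C) in
/-- The Sierpinski object `Σ`. -/
abbrev Sig : C := SierpinskiCategory.Sig

/-- The exponential `Σ^X`. -/
abbrev pow (X : C) : C := SierpinskiCategory.pow X

/-- The propositions in context `Γ` form a lattice, under the intrinsic order. -/
instance instLatticeHom (Γ : C) : Lattice (Γ ⟶ Sig C) :=
  letI : Max (Γ ⟶ Sig C) := ⟨fun a b => lift a b ≫ SierpinskiCategory.join⟩
  letI : Min (Γ ⟶ Sig C) := ⟨fun a b => lift a b ≫ SierpinskiCategory.meet⟩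
  Lattice.mk' SierpinskiCategory.join_comm SierpinskiCategory.join_assoc
    SierpinskiCategory.meet_comm SierpinskiCategory.meet_assoc
    SierpinskiCategory.join_meet_absorb SierpinskiCategory.meet_join_absorb

instance instBoundedOrderHom (Γ : C) : BoundedOrder (Γ ⟶ Sig C) where
  top := toUnit Γ ≫ SierpinskiCategory.top
  bot := toUnit Γ ≫ SierpinskiCategory.bot
  le_top a := inf_eq_left.1 (SierpinskiCategory.meet_top a)
  bot_le a := sup_eq_left.1 (SierpinskiCategory.join_bot a)

/-- `λ`-abstraction: `lam t = λ x. t`, where `t` is over the context `Γ, x : X`. -/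
def lam {Γ X : C} (t : Γ ⊗ X ⟶ Sig C) : Γ ⟶ pow X := SierpinskiCategory.curry t

/-- Application `φ x`. -/
def app {Γ X : C} (φ : Γ ⟶ pow X) (x : Γ ⟶ X) : Γ ⟶ Sig C :=
  lift (𝟙 Γ) x ≫ SierpinskiCategory.curry.symm φ

/-- The intrinsic meet `φ ∧ ψ` in `Σ^X`. -/
def powMeet {Γ X : C} (φ ψ : Γ ⟶ pow X) : Γ ⟶ pow X :=
  lam (app (fst Γ X ≫ φ) (snd Γ X) ⊓ app (fst Γ X ≫ ψ) (snd Γ X))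

/-- The intrinsic join `φ ∨ ψ` in `Σ^X`. -/
def powJoin {Γ X : C} (φ ψ : Γ ⟶ pow X) : Γ ⟶ pow X :=
  lam (app (fst Γ X ≫ φ) (snd Γ X) ⊔ app (fst Γ X ≫ ψ) (snd Γ X))

/-- `E : Σ^X → Σ^X` is a *nucleus* if for `𝓕 : Σ^Σ^Σ^X`,
`E (λ x. 𝓕 (λ φ. φ x)) = E (λ x. 𝓕 (λ φ. E φ x))`. -/
def IsNucleus {X : C} (E : pow X ⟶ pow X) : Prop :=
  ∀ (Γ : C) (F : Γ ⟶ pow (pow (pow X))),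
    lam (app (fst Γ X ≫ F)
        (lam (app (snd (Γ ⊗ X) (pow X)) (fst (Γ ⊗ X) (pow X) ≫ snd Γ X)))) ≫ E =
      lam (app (fst Γ X ≫ F)
        (lam (app (snd (Γ ⊗ X) (pow X) ≫ E) (fst (Γ ⊗ X) (pow X) ≫ snd Γ X)))) ≫ E

/-- `N` is *overt* and *discrete*: there is an existential quantifier `ex : Σ^N → Σ`, left adjoint
to `Σ → Σ^N`, and an internal equality `eq : N × N → Σ`, classifying the diagonal. -/
class OvertDiscrete (N : C) where
  ex : pow N ⟶ Sig C
  ex_le_iff {Γ : C} (φ : Γ ⟶ pow N) (σ : Γ ⟶ Sig C) :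
    φ ≫ ex ≤ σ ↔ app (fst Γ N ≫ φ) (snd Γ N) ≤ fst Γ N ≫ σ
  eq : N ⊗ N ⟶ Sig C
  eq_eq_top_iff {Γ : C} (n m : Γ ⟶ N) : lift n m ≫ eq = ⊤ ↔ n = m

/-- `∃ n : N. t`, where `t` is over the context `Γ, n : N`. -/
def exi {Γ N : C} [OvertDiscrete N] (t : Γ ⊗ N ⟶ Sig C) : Γ ⟶ Sig C :=
  lam t ≫ OvertDiscrete.ex

/-- The internal equality `n = m` of terms of type `N`. -/
def eqN {Γ N : C} [OvertDiscrete N] (n m : Γ ⟶ N) : Γ ⟶ Sig C :=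
  lift n m ≫ OvertDiscrete.eq

/-- The object `list = List N` of lists, given by primitive recursion with parameters at all
types, together with the uniqueness of recursively defined terms (equational induction). -/
class ListObject (N : C) where
  list : C
  nil : 𝟙_ C ⟶ list
  cons : N ⊗ list ⟶ list
  fold {Γ X : C} (z : Γ ⟶ X) (s : Γ ⊗ (N ⊗ X) ⟶ X) : Γ ⊗ list ⟶ X
  fold_nil {Γ X : C} (z : Γ ⟶ X) (s : Γ ⊗ (N ⊗ X) ⟶ X) :
    lift (𝟙 Γ) (toUnit Γ ≫ nil) ≫ fold z s = z
  fold_cons {Γ X : C} (z : Γ ⟶ X) (s : Γ ⊗ (N ⊗ X) ⟶ X) :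
    Γ ◁ cons ≫ fold z s =
      lift (fst Γ (N ⊗ list)) (lift (snd Γ (N ⊗ list) ≫ fst N list)
        (Γ ◁ snd N list ≫ fold z s)) ≫ s
  fold_unique {Γ X : C} (z : Γ ⟶ X) (s : Γ ⊗ (N ⊗ X) ⟶ X) (f : Γ ⊗ list ⟶ X) :
    lift (𝟙 Γ) (toUnit Γ ≫ nil) ≫ f = z →
    Γ ◁ cons ≫ f =
      lift (fst Γ (N ⊗ list)) (lift (snd Γ (N ⊗ list) ≫ fst N list)
        (Γ ◁ snd N list ≫ f)) ≫ s →
    f = fold z s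

/-- The object of lists on `N`. -/
abbrev Lst (N : C) [ListObject N] : C := ListObject.list N

/-- The result of the list recursion with base value `z` and step `(h, x) ↦ s (h, x)`, at `l`. -/
def foldAt {Γ X N : C} [ListObject N] (z : Γ ⟶ X) (s : Γ ⊗ (N ⊗ X) ⟶ X) (l : Γ ⟶ Lst N) :
    Γ ⟶ X :=
  lift (𝟙 Γ) l ≫ ListObject.fold z s

/-- `∃ m ∈ l. t`, where `t` is over `Γ, m : N`:  it is `⊥` for the empty list and
`t h ∨ ∃ m ∈ l. t` for `h :: l`. -/
def existsIn {Γ N : C} [ListObject N] (l : Γ ⟶ Lst N) (t : Γ ⊗ N ⟶ Sig C) : Γ ⟶ Sig C :=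
  foldAt ⊥ ((Γ ◁ fst N (Sig C) ≫ t) ⊔ (snd Γ (N ⊗ Sig C) ≫ snd N (Sig C))) l

/-- `∀ m ∈ l. t`, where `t` is over `Γ, m : N`:  it is `⊤` for the empty list and
`t h ∧ ∀ m ∈ l. t` for `h :: l`. -/
def forallIn {Γ N : C} [ListObject N] (l : Γ ⟶ Lst N) (t : Γ ⊗ N ⟶ Sig C) : Γ ⟶ Sig C :=
  foldAt ⊤ ((Γ ◁ fst N (Sig C) ≫ t) ⊓ (snd Γ (N ⊗ Sig C) ≫ snd N (Sig C))) l

/-- Membership `n ∈ l`. -/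
def mem {Γ N : C} [OvertDiscrete N] [ListObject N] (n : Γ ⟶ N) (l : Γ ⟶ Lst N) : Γ ⟶ Sig C :=
  existsIn l (eqN (snd Γ N) (fst Γ N ≫ n))

/-- The predicate `λ m. m ∈ l` on `N`. -/
def elems {Γ N : C} [OvertDiscrete N] [ListObject N] (l : Γ ⟶ Lst N) : Γ ⟶ pow N :=
  lam (mem (snd Γ N) (fst Γ N ≫ l))

/-- The *Scott principle* for `N`: for `Φ : Σ^Σ^N` and `ξ : Σ^N`,
`Φ ξ ⇔ ∃ l : List N. Φ (λ n. n ∈ l) ∧ ∀ n ∈ l. ξ n`. -/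
def ScottPrinciple (N : C) [OvertDiscrete N] [ListObject N] [OvertDiscrete (Lst N)] : Prop :=
  ∀ (Γ : C) (Φ : Γ ⟶ pow (pow N)) (ξ : Γ ⟶ pow N),
    app Φ ξ =
      exi (N := Lst N)
        (app (fst Γ (Lst N) ≫ Φ) (elems (snd Γ (Lst N))) ⊓
          forallIn (snd Γ (Lst N))
            (app (fst (Γ ⊗ Lst N) N ≫ fst Γ (Lst N) ≫ ξ) (snd (Γ ⊗ Lst N) N)))

end Terms

/-- A categorical model of the calculus of abstract Stone duality, as far as it is relevant here:
every overt discrete object `N` has an object `List N`, which is again overt discrete, and the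
Scott principle holds.  The natural numbers object is `List 1`.  Monadicity of the adjunction
`Σ^(-) ⊣ Σ^(-)` (sobriety and `Σ`-split subobjects) is not demanded, so statements about all
models in this sense hold in particular in those that are monadic. -/
class Model (C : Type u) [Category.{v} C] [CartesianMonoidalCategory C] extends
    SierpinskiCategory C where
  listObject (N : C) [OvertDiscrete N] : ListObject N
  overtDiscreteList (N : C) [OvertDiscrete N] :
    letI := listObject N
    OvertDiscrete (Lst N)
  scott (N : C) [OvertDiscrete N] :
    letI := listObject N
    letI := overtDiscreteList N
    ScottPrinciple N

section Basis

variable {C : Type u} [Category.{v} C] [CartesianMonoidalCategory C] [Model C]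

instance instListObject (N : C) [OvertDiscrete N] : ListObject N := Model.listObject N

instance instOvertDiscreteLst (N : C) [OvertDiscrete N] : OvertDiscrete (Lst N) :=
  Model.overtDiscreteList N

/-- The operations of an imposed lattice structure on `N`. -/
structure ImposedOps (N : C) where
  zero : 𝟙_ C ⟶ N
  one : 𝟙_ C ⟶ N
  add : N ⊗ N ⟶ N
  star : N ⊗ N ⟶ N

namespace ImposedOps

variable {N : C} (S : ImposedOps N)

/-- The element `0` in context `Γ`. -/
def zeroAt (Γ : C) : Γ ⟶ N := toUnit Γ ≫ S.zero

/-- The element `1` in context `Γ`. -/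
def oneAt (Γ : C) : Γ ⟶ N := toUnit Γ ≫ S.one

/-- `n + m` -/
def plus {Γ : C} (n m : Γ ⟶ N) : Γ ⟶ N := lift n m ≫ S.add

/-- `n ⋆ m` -/
def times {Γ : C} (n m : Γ ⟶ N) : Γ ⟶ N := lift n m ≫ S.star

end ImposedOps

/-- The open binary relation `r`, applied to two terms. -/
def rel {N : C} (r : N ⊗ N ⟶ Sig C) {Γ : C} (n m : Γ ⟶ N) : Γ ⟶ Sig C := lift n m ≫ r

/-- The rules for the imposed order of a distributive lattice, for an open relation `r`. -/
structure IsLatticeOrder {N : C} (S : ImposedOps N) (r : N ⊗ N ⟶ Sig C) : Prop where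
  zero_le {Γ : C} (n : Γ ⟶ N) : rel r (S.zeroAt Γ) n = ⊤
  refl {Γ : C} (n : Γ ⟶ N) : rel r n n = ⊤
  le_one {Γ : C} (n : Γ ⟶ N) : rel r n (S.oneAt Γ) = ⊤
  distrib {Γ : C} (k n m : Γ ⟶ N) :
    rel r (S.times k (S.plus n m)) (S.plus (S.times k n) (S.times k m)) = ⊤
  trans {Γ : C} (n k m : Γ ⟶ N) : rel r n k ⊓ rel r k m ≤ rel r n m
  le_star {Γ : C} (k m n : Γ ⟶ N) : rel r k m ⊓ rel r k n = rel r k (S.times m n)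
  add_le {Γ : C} (n m k : Γ ⟶ N) : rel r n k ⊓ rel r m k = rel r (S.plus n m) k

/-- An *abstract basis* on an overt discrete object `N`.  The relation `le` is the imposed order
`≼`, the least open relation satisfying the rules for the order of a distributive lattice, and
is thereby determined by `(0, 1, +, ⋆)`; the relation `wb` is `≪`. -/
structure AbstractBasis (N : C) [OvertDiscrete N] extends ImposedOps N where
  le : N ⊗ N ⟶ Sig C
  le_isLatticeOrder : IsLatticeOrder toImposedOps le
  le_least (r : N ⊗ N ⟶ Sig C) : IsLatticeOrder toImposedOps r → le ≤ r
  wb : N ⊗ N ⟶ Sig C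
  wb_zero {Γ : C} : rel wb (toImposedOps.zeroAt Γ) (toImposedOps.zeroAt Γ) = ⊤
  /-- `n ≪ p` and `m ≪ p` iff `n + m ≪ p` -/
  add_wb {Γ : C} (n m p : Γ ⟶ N) :
    rel wb n p ⊓ rel wb m p = rel wb (toImposedOps.plus n m) p
  /-- if `m' ≼ m ≪ n ≼ n'` then `m' ≪ n'` -/
  wb_mono {Γ : C} (m' m n n' : Γ ⟶ N) :
    rel le m' m ⊓ rel wb m n ⊓ rel le n n' ≤ rel wb m' n'
  /-- `n ≪ m` iff `n ≪ k ≪ m` for some `k` -/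
  interpolation {Γ : C} (n m : Γ ⟶ N) :
    rel wb n m =
      exi (rel wb (fst Γ N ≫ n) (snd Γ N) ⊓ rel wb (snd Γ N) (fst Γ N ≫ m))
  /-- if `n ≪ m`, `m ≪ p` and `m ≪ q` then `n ≪ p ⋆ q` -/
  wb_star {Γ : C} (n m p q : Γ ⟶ N) :
    rel wb n m ⊓ rel wb m p ⊓ rel wb m q ≤ rel wb n (toImposedOps.times p q)
  /-- `n ≪ p + q` iff `n ≪ p' + q'`, `p' ≪ p` and `q' ≪ q` for some `p'` and `q'` -/
  wilker {Γ : C} (n p q : Γ ⟶ N) :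
    rel wb n (toImposedOps.plus p q) =
      exi (Γ := Γ) (N := N) (exi (Γ := Γ ⊗ N) (N := N)
        (let w : (Γ ⊗ N) ⊗ N ⟶ Γ := fst (Γ ⊗ N) N ≫ fst Γ N
         let p' : (Γ ⊗ N) ⊗ N ⟶ N := fst (Γ ⊗ N) N ≫ snd Γ N
         let q' : (Γ ⊗ N) ⊗ N ⟶ N := snd (Γ ⊗ N) N
         rel wb (w ≫ n) (toImposedOps.plus p' q') ⊓ rel wb p' (w ≫ p) ⊓ rel wb q' (w ≫ q)))

variable {N : C} [OvertDiscrete N]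

/-- The dual basis element `𝒜_L Φ = ∀ l ∈ L. Φ (λ m. m ∈ l)`. -/
def dualBasis {Γ : C} (L : Γ ⟶ Lst (Lst N)) (Φ : Γ ⟶ pow (pow N)) : Γ ⟶ Sig C :=
  forallIn L (app (fst Γ (Lst N) ≫ Φ) (elems (snd Γ (Lst N))))

namespace ImposedOps

variable (S : ImposedOps N)

/-- The product `μ l` of a list: `μ [] = 1` and `μ (h :: l) = h ⋆ μ l`. -/
def prod {Γ : C} (l : Γ ⟶ Lst N) : Γ ⟶ N :=
  foldAt (S.oneAt Γ) (snd Γ (N ⊗ N) ≫ S.star) l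

/-- The value `ev L` of a formal sum of products: `ev [] = 0` and `ev (l :: L) = μ l + ev L`. -/
def ev {Γ : C} (L : Γ ⟶ Lst (Lst N)) : Γ ⟶ N :=
  foldAt (S.zeroAt Γ)
    (S.plus (S.prod (snd Γ (Lst N ⊗ N) ≫ fst (Lst N) N)) (snd Γ (Lst N ⊗ N) ≫ snd (Lst N) N)) L

end ImposedOps

namespace AbstractBasis

variable (B : AbstractBasis N)

/-- `∃ n. ∃ L. ξ n ∧ (n ≪ ev L) ∧ 𝒜_L Φ` -/
def nucleusAt {Γ : C} (Φ : Γ ⟶ pow (pow N)) (ξ : Γ ⟶ pow N) : Γ ⟶ Sig C :=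
  exi (Γ := Γ) (N := N) (exi (Γ := Γ ⊗ N) (N := Lst (Lst N))
    (let w : (Γ ⊗ N) ⊗ Lst (Lst N) ⟶ Γ := fst (Γ ⊗ N) (Lst (Lst N)) ≫ fst Γ N
     let n : (Γ ⊗ N) ⊗ Lst (Lst N) ⟶ N := fst (Γ ⊗ N) (Lst (Lst N)) ≫ snd Γ N
     let L : (Γ ⊗ N) ⊗ Lst (Lst N) ⟶ Lst (Lst N) := snd (Γ ⊗ N) (Lst (Lst N))
     app (w ≫ ξ) n ⊓ rel B.wb n (B.ev L) ⊓ dualBasis L (w ≫ Φ)))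

/-- The endomorphism `E = λ Φ. λ ξ. ∃ n. ∃ L. ξ n ∧ (n ≪ ev L) ∧ 𝒜_L Φ` of `Σ^Σ^N`. -/
def nucleus : pow (pow N) ⟶ pow (pow N) :=
  lam (B.nucleusAt (fst (pow (pow N)) (pow N)) (snd (pow (pow N)) (pow N)))

end AbstractBasis

end Basis

end ASD

namespace ASD

attribute [local simp] comp_lift comp_lift_assoc

/-! ### Sequent reasoning in the internal language of a category with `Σ`. -/

section Logic

variable {C : Type u} [Category.{v} C] [CartesianMonoidalCategory C] [SierpinskiCategory C]

/-! ### Substitution -/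

/-! Since `Σ` has neither implication nor universal quantification, reasoning is in Kripke–Joyal
style: `h ≤ a` says that `a` holds under hypothesis `h`, and an elimination rule passes to a new
context `f : Δ ⟶ Γ` and a stronger hypothesis `k ≤ f ≫ h`. The Phoa principle makes every `F :
Σ^Σ^X` monotone even under a hypothesis (`app_mono`), which yields the Frobenius law for `∃`.
Uniqueness of list recursion yields induction for sequents.

Call `n` covered by `Φ` if `n ≪ ev L` for some `L` with `𝒜_L Φ`, so that `E Φ ξ` says that some `n`
in `ξ` is covered by `Φ`. The Wilker rule shows that, to prove `E Φ ≤ E Ψ`, it is enough that `Ψ`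
covers every `p ≪ μ l` for which `Φ` holds at the finite set of members of `l`
(`covered_le_covered`, `nucleusAt_mono`). Interpolate `p ≪ q ≪ μ l`. Two facts link `E` with
covering: if `Φ` holds at `l` then `E Φ` holds at `{q}` (`nucleusAt_singleton`), and if `E Φ` holds
at `l` then `Φ` covers `q` (`nucleusAt_elems`). The first proves `≤` in all three equations. For
`≥`, the second reduces the meet equation to stability of covering under binary meets, where the `⋆`
rule is used, and the join equation to monotonicity.

For `≥` in the nucleus equation, `F` is known to hold at `λ φ. (φ covers q)`, that is, at `λ φ. ∃ L.
q ≪ ev L ∧ 𝒜_L φ`. The Scott principle on `List (List N)` replaces the set of all `L` with `q ≪ ev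
L` by a finite list of them. Each such `L` gives a basic predicate that covers `q`, their finite
meet covers `p`, and at any point of that meet every `φ` with some `𝒜_L φ` is true, so `F (λ φ. φ
x)` holds there (`covered_of_app_covered`). -/

lemma sup_def {Γ : C} (a b : Γ ⟶ Sig C) : a ⊔ b = lift a b ≫ SierpinskiCategory.join := rfl

lemma inf_def {Γ : C} (a b : Γ ⟶ Sig C) : a ⊓ b = lift a b ≫ SierpinskiCategory.meet := rfl

lemma top_def {Γ : C} : (⊤ : Γ ⟶ Sig C) = toUnit Γ ≫ SierpinskiCategory.top := rfl

lemma bot_def {Γ : C} : (⊥ : Γ ⟶ Sig C) = toUnit Γ ≫ SierpinskiCategory.bot := rfl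

@[simp] lemma comp_sup {Δ Γ : C} (f : Δ ⟶ Γ) (a b : Γ ⟶ Sig C) :
    f ≫ (a ⊔ b) = f ≫ a ⊔ f ≫ b := by simp [sup_def]

@[simp] lemma comp_inf {Δ Γ : C} (f : Δ ⟶ Γ) (a b : Γ ⟶ Sig C) :
    f ≫ (a ⊓ b) = f ≫ a ⊓ f ≫ b := by simp [inf_def]

@[simp] lemma comp_top {Δ Γ : C} (f : Δ ⟶ Γ) : f ≫ (⊤ : Γ ⟶ Sig C) = ⊤ := by simp [top_def]

@[simp] lemma comp_bot {Δ Γ : C} (f : Δ ⟶ Γ) : f ≫ (⊥ : Γ ⟶ Sig C) = ⊥ := by simp [bot_def]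

lemma comp_le_comp {Δ Γ : C} (f : Δ ⟶ Γ) {a b : Γ ⟶ Sig C} (h : a ≤ b) : f ≫ a ≤ f ≫ b := by
  rw [← inf_eq_left, ← comp_inf, inf_eq_left.2 h]

/-- Truth of a proposition is stable under a change of the world. -/
lemma transport {Δ Γ : C} {f : Δ ⟶ Γ} {k : Δ ⟶ Sig C} {h a : Γ ⟶ Sig C} (hk : k ≤ f ≫ h)
    (H : h ≤ a) : k ≤ f ≫ a := hk.trans (comp_le_comp f H)

/-- Distributivity of `Σ` splits `h` as `(h ⊓ a) ⊔ (h ⊓ b)`, so case analysis is sound under a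
hypothesis. -/
lemma sup_elim {Γ : C} {h a b c : Γ ⟶ Sig C} (H : h ≤ a ⊔ b)
    (Ha : ∀ k ≤ h, k ≤ a → k ≤ c) (Hb : ∀ k ≤ h, k ≤ b → k ≤ c) : h ≤ c := by
  have e : h = h ⊓ (a ⊔ b) := (inf_eq_left.2 H).symm
  have d : h ⊓ (a ⊔ b) = (h ⊓ a) ⊔ (h ⊓ b) := SierpinskiCategory.meet_join_distrib h a b
  rw [e, d]
  exact sup_le (Ha _ inf_le_left inf_le_right) (Hb _ inf_le_left inf_le_right)

@[simp] lemma comp_lam {Δ Γ X : C} (f : Δ ⟶ Γ) (t : Γ ⊗ X ⟶ Sig C) :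
    f ≫ lam t = lam (lift (fst Δ X ≫ f) (snd Δ X) ≫ t) := by
  rw [lam, lam, ← SierpinskiCategory.curry_natural]
  congr 2
  ext <;> simp

lemma uncurry_comp {Δ Γ X : C} (f : Δ ⟶ Γ) (φ : Γ ⟶ pow X) :
    SierpinskiCategory.curry.symm (f ≫ φ) = f ▷ X ≫ SierpinskiCategory.curry.symm φ := by
  rw [Equiv.symm_apply_eq, SierpinskiCategory.curry_natural, Equiv.apply_symm_apply]

@[simp] lemma comp_app {Δ Γ X : C} (f : Δ ⟶ Γ) (φ : Γ ⟶ pow X) (x : Γ ⟶ X) :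
    f ≫ app φ x = app (f ≫ φ) (f ≫ x) := by
  simp [app, uncurry_comp]

@[simp] lemma app_lam {Γ X : C} (t : Γ ⊗ X ⟶ Sig C) (x : Γ ⟶ X) :
    app (lam t) x = lift (𝟙 Γ) x ≫ t := by
  simp [app, lam]

lemma lam_app {Γ X : C} (φ : Γ ⟶ pow X) : lam (app (fst Γ X ≫ φ) (snd Γ X)) = φ := by
  simp [app, lam, uncurry_comp]

lemma pow_ext {Γ X : C} {φ ψ : Γ ⟶ pow X}
    (h : ∀ {Δ : C} (f : Δ ⟶ Γ) (x : Δ ⟶ X), app (f ≫ φ) x = app (f ≫ ψ) x) : φ = ψ := by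
  rw [← lam_app φ, ← lam_app ψ, h]

/-! ### Consequences of the Phoa principle -/

lemma phoa_lam {Γ : C} (t : Γ ⊗ Sig C ⟶ Sig C) (σ : Γ ⟶ Sig C) :
    lift (𝟙 Γ) σ ≫ t = lift (𝟙 Γ) ⊥ ≫ t ⊔ σ ⊓ lift (𝟙 Γ) ⊤ ≫ t := by
  simpa [lam, sup_def, inf_def, top_def, bot_def] using SierpinskiCategory.phoa (lam t) σ

/-- Phoa for `σ ↦ F (φ ∨ (σ ∧ ψ))` at `σ = ⊤`: the value at `⊥` is `F φ`, and the value at `⊤` is `F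
ψ`. -/
lemma app_le_app {Γ X : C} (F : Γ ⟶ pow (pow X)) {φ ψ : Γ ⟶ pow X}
    (h : app (fst Γ X ≫ φ) (snd Γ X) ≤ app (fst Γ X ≫ ψ) (snd Γ X)) : app F φ ≤ app F ψ := by
  have key := phoa_lam (app (fst Γ (Sig C) ≫ F)
    (lam (app (fst _ X ≫ fst Γ (Sig C) ≫ φ) (snd _ X) ⊔
      (fst _ X ≫ snd Γ (Sig C)) ⊓ app (fst _ X ≫ fst Γ (Sig C) ≫ ψ) (snd _ X)))) ⊤
  simp only [comp_app, lift_fst_assoc, Category.id_comp, comp_lam, comp_sup, comp_inf,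
    lift_snd, Category.assoc, comp_bot, comp_top, bot_inf_eq, sup_bot_eq, top_inf_eq,
    lam_app, sup_eq_right.2 h] at key
  rw [key]
  exact le_sup_left

/-- Operations on predicates respect conditional implication. -/
lemma app_mono {Γ X : C} {h : Γ ⟶ Sig C} {F : Γ ⟶ pow (pow X)} {φ ψ : Γ ⟶ pow X}
    (H : h ≤ app F φ)
    (K : ∀ {Δ : C} (f : Δ ⟶ Γ) (x : Δ ⟶ X) (k : Δ ⟶ Sig C), k ≤ f ≫ h → k ≤ app (f ≫ φ) x →
      k ≤ app (f ≫ ψ) x) : h ≤ app F ψ := by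
  -- Phoa for `σ ↦ F (ψ ∨ (σ ∧ φ))` at `σ = h`. The left side is `F ψ`, because `h ∧ φ ≤ ψ`; the
  -- right side contains `h ∧ F (ψ ∨ φ)`, which is above `h`.
  have key := phoa_lam (app (fst Γ (Sig C) ≫ F)
    (lam (app (fst _ X ≫ fst Γ (Sig C) ≫ ψ) (snd _ X) ⊔
      (fst _ X ≫ snd Γ (Sig C)) ⊓ app (fst _ X ≫ fst Γ (Sig C) ≫ φ) (snd _ X)))) h
  have K' := K (fst Γ X) (snd Γ X) _ inf_le_left inf_le_right
  simp only [comp_app, lift_fst_assoc, Category.id_comp, comp_lam, comp_sup, comp_inf,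
    lift_snd, Category.assoc, comp_bot, comp_top, bot_inf_eq, sup_bot_eq, top_inf_eq,
    lam_app, sup_eq_left.2 K'] at key
  rw [key]
  refine le_sup_of_le_right (le_inf le_rfl (H.trans (app_le_app F ?_)))
  simp

/-! ### Existential quantification -/

section Exists

variable {N : C} [OvertDiscrete N]

@[simp] lemma comp_exi {Δ Γ : C} (f : Δ ⟶ Γ) (t : Γ ⊗ N ⟶ Sig C) :
    f ≫ exi t = exi (lift (fst Δ N ≫ f) (snd Δ N) ≫ t) := by
  rw [exi, exi, ← Category.assoc, comp_lam]

lemma exi_le_iff {Γ : C} (t : Γ ⊗ N ⟶ Sig C) (σ : Γ ⟶ Sig C) :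
    exi t ≤ σ ↔ t ≤ fst Γ N ≫ σ := by
  simp [exi, OvertDiscrete.ex_le_iff]

lemma exi_intro {Γ : C} {h : Γ ⟶ Sig C} {t : Γ ⊗ N ⟶ Sig C} (x : Γ ⟶ N)
    (H : h ≤ lift (𝟙 Γ) x ≫ t) : h ≤ exi t := by
  have := comp_le_comp (lift (𝟙 Γ) x) ((exi_le_iff t _).1 le_rfl)
  simp only [lift_fst_assoc, Category.id_comp] at this
  exact H.trans this

/-- The Frobenius law: `app_mono` applied to `∃` replaces `t` by the constant predicate `c` under
the hypothesis `h`, and `∃` of a constant is below that constant. -/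
lemma exi_elim {Γ : C} {h c : Γ ⟶ Sig C} {t : Γ ⊗ N ⟶ Sig C} (H : h ≤ exi t)
    (K : ∀ {Δ : C} (f : Δ ⟶ Γ) (x : Δ ⟶ N) (k : Δ ⟶ Sig C), k ≤ f ≫ h → k ≤ lift f x ≫ t →
      k ≤ f ≫ c) : h ≤ c := by
  have := app_mono (F := lam (snd Γ (pow N) ≫ OvertDiscrete.ex)) (φ := lam t)
    (ψ := lam (fst Γ N ≫ c)) (h := h) (by simpa [exi] using H)
    (fun f x k hk ht => by simpa using K f x k hk (by simpa using ht))
  simp only [app_lam, lift_snd_assoc] at this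
  exact this.trans ((exi_le_iff _ _).2 le_rfl)

end Exists

end Logic

/-! ### List recursion and induction for sequents. -/

section Lists

variable {C : Type u} [Category.{v} C] [CartesianMonoidalCategory C]

variable {M : C} [ListObject M]

/-- The empty list in context `Γ`. -/
def nilAt (M : C) [ListObject M] (Γ : C) : Γ ⟶ Lst M := toUnit Γ ≫ ListObject.nil

/-- The list with head `x` and tail `l`. -/
def consAt {Γ : C} (x : Γ ⟶ M) (l : Γ ⟶ Lst M) : Γ ⟶ Lst M := lift x l ≫ ListObject.cons

@[simp] lemma comp_nilAt {Δ Γ : C} (f : Δ ⟶ Γ) : f ≫ nilAt M Γ = nilAt M Δ := by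
  simp [nilAt]

@[simp] lemma comp_consAt {Δ Γ : C} (f : Δ ⟶ Γ) (x : Γ ⟶ M) (l : Γ ⟶ Lst M) :
    f ≫ consAt x l = consAt (f ≫ x) (f ≫ l) := by
  simp [consAt]

lemma whiskerRight_fold {Δ Γ X : C} (f : Δ ⟶ Γ) (z : Γ ⟶ X) (s : Γ ⊗ (M ⊗ X) ⟶ X) :
    f ▷ Lst M ≫ ListObject.fold z s =
      ListObject.fold (f ≫ z) (lift (fst Δ (M ⊗ X) ≫ f) (snd Δ (M ⊗ X)) ≫ s) := by
  refine ListObject.fold_unique _ _ _ ?_ ?_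
  · have := congrArg (f ≫ ·) (ListObject.fold_nil (N := M) z s)
    simp only [comp_lift_assoc, comp_toUnit_assoc, Category.comp_id] at this
    simpa using this
  · rw [← Category.assoc, whisker_exchange, Category.assoc, ListObject.fold_cons]
    simp only [comp_lift_assoc, lift_snd]
    refine congrArg (· ≫ s) (CartesianMonoidalCategory.hom_ext _ _ ?_ ?_)
    · simp
    · simp only [comp_lift, lift_snd, ← whisker_exchange_assoc, whiskerRight_snd_assoc]

lemma lift_fold {Δ Γ X : C} (f : Δ ⟶ Γ) (l : Δ ⟶ Lst M) (z : Γ ⟶ X) (s : Γ ⊗ (M ⊗ X) ⟶ X) :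
    lift f l ≫ ListObject.fold z s =
      foldAt (f ≫ z) (lift (fst Δ (M ⊗ X) ≫ f) (snd Δ (M ⊗ X)) ≫ s) l := by
  rw [foldAt, ← whiskerRight_fold]
  simp

@[simp] lemma comp_foldAt {Δ Γ X : C} (f : Δ ⟶ Γ) (l : Γ ⟶ Lst M) (z : Γ ⟶ X)
    (s : Γ ⊗ (M ⊗ X) ⟶ X) :
    f ≫ foldAt z s l =
      foldAt (f ≫ z) (lift (fst Δ (M ⊗ X) ≫ f) (snd Δ (M ⊗ X)) ≫ s) (f ≫ l) := by
  rw [foldAt, comp_lift_assoc, lift_fold, Category.comp_id]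

@[simp] lemma foldAt_nil {Γ X : C} (z : Γ ⟶ X) (s : Γ ⊗ (M ⊗ X) ⟶ X) :
    foldAt z s (nilAt M Γ) = z := ListObject.fold_nil z s

@[simp] lemma foldAt_cons {Γ X : C} (z : Γ ⟶ X) (s : Γ ⊗ (M ⊗ X) ⟶ X) (x : Γ ⟶ M)
    (l : Γ ⟶ Lst M) :
    foldAt z s (consAt x l) = lift (𝟙 Γ) (lift x (foldAt z s l)) ≫ s := by
  have := congrArg (lift (𝟙 Γ) (lift x l) ≫ ·) (ListObject.fold_cons (N := M) z s)
  simpa [foldAt, consAt] using this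

/-- Two terms that satisfy the same primitive recursion are equal. -/
lemma list_ext {Γ X : C} {f g : Γ ⊗ Lst M ⟶ X} (s : Γ ⊗ (M ⊗ (Lst M ⊗ X)) ⟶ X)
    (hnil : lift (𝟙 Γ) (nilAt M Γ) ≫ f = lift (𝟙 Γ) (nilAt M Γ) ≫ g)
    (hf : ∀ {Δ : C} (γ : Δ ⟶ Γ) (x : Δ ⟶ M) (l : Δ ⟶ Lst M),
      lift γ (consAt x l) ≫ f = lift γ (lift x (lift l (lift γ l ≫ f))) ≫ s)
    (hg : ∀ {Δ : C} (γ : Δ ⟶ Γ) (x : Δ ⟶ M) (l : Δ ⟶ Lst M),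
      lift γ (consAt x l) ≫ g = lift γ (lift x (lift l (lift γ l ≫ g))) ≫ s) : f = g := by
  -- The step `s` may inspect the tail, which a plain fold cannot; carrying the list along with the
  -- value turns the recursion into a fold.
  have key : ∀ f : Γ ⊗ Lst M ⟶ X, (∀ {Δ : C} (γ : Δ ⟶ Γ) (x : Δ ⟶ M) (l : Δ ⟶ Lst M),
      lift γ (consAt x l) ≫ f = lift γ (lift x (lift l (lift γ l ≫ f))) ≫ s) →
      lift (snd Γ (Lst M)) f = ListObject.fold (lift (nilAt M Γ) (lift (𝟙 Γ) (nilAt M Γ) ≫ f))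
        (lift (consAt (snd Γ (M ⊗ (Lst M ⊗ X)) ≫ fst M _)
          (snd Γ (M ⊗ (Lst M ⊗ X)) ≫ snd M _ ≫ fst _ _)) s) := by
    intro f hf
    have e : ∀ {Y : C} (t : Γ ⊗ Lst M ⟶ Y), Γ ◁ snd M (Lst M) ≫ t =
        lift (fst Γ (M ⊗ Lst M)) (snd Γ (M ⊗ Lst M) ≫ snd M (Lst M)) ≫ t := by
      intro Y t; congr 1; ext <;> simp
    have e' : ∀ {Y : C} (t : Γ ⊗ Lst M ⟶ Y), Γ ◁ ListObject.cons ≫ t =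
        lift (fst Γ (M ⊗ Lst M)) (consAt (snd Γ (M ⊗ Lst M) ≫ fst M (Lst M))
          (snd Γ (M ⊗ Lst M) ≫ snd M (Lst M))) ≫ t := by
      intro Y t; congr 1; ext <;> simp [consAt]
    refine ListObject.fold_unique _ _ _ (by simp [nilAt]) ?_
    simp only [e, e', comp_lift, lift_snd, hf, comp_consAt, lift_fst, lift_snd_assoc]
  have := (key f hf).trans (by rw [hnil, ← key g hg])
  simpa only [lift_snd] using congrArg (· ≫ snd _ _) this

variable [SierpinskiCategory C]

/-- Induction for a sequent of propositions about lists. -/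
lemma list_induction {Γ : C} {a b : Γ ⊗ Lst M ⟶ Sig C}
    (hnil : lift (𝟙 Γ) (nilAt M Γ) ≫ a ≤ lift (𝟙 Γ) (nilAt M Γ) ≫ b)
    (htail : ∀ {Δ : C} (γ : Δ ⟶ Γ) (x : Δ ⟶ M) (l : Δ ⟶ Lst M),
      lift γ (consAt x l) ≫ a ≤ lift γ l ≫ a)
    (hcons : ∀ {Δ : C} (γ : Δ ⟶ Γ) (x : Δ ⟶ M) (l : Δ ⟶ Lst M) (k : Δ ⟶ Sig C),
      k ≤ lift γ (consAt x l) ≫ a → k ≤ lift γ l ≫ b → k ≤ lift γ (consAt x l) ≫ b) :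
    a ≤ b := by
  have : a ⊓ b = a := by
    -- Both `a ⊓ b` and `a` satisfy the recursion `v ↦ a (x :: l) ∧ (v ∨ b (x :: l))`: the former by
    -- `hcons`, the latter by `htail`.
    refine list_ext (lift (fst _ _) (consAt (snd _ _ ≫ fst _ _) (snd _ _ ≫ snd _ _ ≫ fst _ _)) ≫ a ⊓
      ((snd _ _ ≫ snd _ _ ≫ snd _ _) ⊔
        lift (fst _ _) (consAt (snd _ _ ≫ fst _ _) (snd _ _ ≫ snd _ _ ≫ fst _ _)) ≫ b)) ?_ ?_ ?_
    · simpa using hnil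
    · intro Δ γ x l
      simp only [comp_inf, comp_sup, comp_lift_assoc, comp_consAt, lift_fst, lift_snd_assoc,
        lift_snd]
      refine le_antisymm (inf_le_inf_left _ le_sup_right) (le_inf inf_le_left ?_)
      refine sup_elim inf_le_right (fun k hk h => ?_) (fun k hk h => h)
      exact hcons γ x l k (hk.trans inf_le_left) (h.trans inf_le_right)
    · intro Δ γ x l
      simp only [comp_inf, comp_sup, comp_lift_assoc, comp_consAt, lift_fst, lift_snd_assoc,
        lift_snd]
      exact (inf_eq_left.2 ((htail γ x l).trans le_sup_left)).symm
  exact inf_eq_left.1 this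

/-- Induction for a sequent of propositions about lists and a varying parameter in `Y`. -/
lemma list_induction_param {Γ Y : C} [OvertDiscrete Y] {a : (Γ ⊗ Lst M) ⊗ Y ⟶ Sig C}
    {b : Γ ⊗ Y ⟶ Sig C} (R : (Γ ⊗ M) ⊗ (Y ⊗ Y) ⟶ Sig C)
    (hnil : ∀ {Δ : C} (γ : Δ ⟶ Γ) (y : Δ ⟶ Y), lift (lift γ (nilAt M Δ)) y ≫ a ≤ lift γ y ≫ b)
    (htail : ∀ {Δ : C} (γ : Δ ⟶ Γ) (x : Δ ⟶ M) (l : Δ ⟶ Lst M) (y : Δ ⟶ Y),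
      lift (lift γ (consAt x l)) y ≫ a ≤
        exi (lift (lift (fst Δ Y ≫ γ) (fst Δ Y ≫ x)) (lift (fst Δ Y ≫ y) (snd Δ Y)) ≫ R ⊓
          lift (lift (fst Δ Y ≫ γ) (fst Δ Y ≫ l)) (snd Δ Y) ≫ a))
    (hcons : ∀ {Δ : C} (γ : Δ ⟶ Γ) (x : Δ ⟶ M) (l : Δ ⟶ Lst M) (y y' : Δ ⟶ Y) (k : Δ ⟶ Sig C),
      k ≤ lift (lift γ (consAt x l)) y ≫ a → k ≤ lift (lift γ x) (lift y y') ≫ R →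
      k ≤ lift γ y' ≫ b → k ≤ lift γ y ≫ b)
    (l : Γ ⟶ Lst M) (y : Γ ⟶ Y) : lift (lift (𝟙 Γ) l) y ≫ a ≤ lift (𝟙 Γ) y ≫ b := by
  have : lam (a ⊓ lift (fst _ _ ≫ fst _ _) (snd _ _) ≫ b) = lam a := by
    -- The recursion takes values in `Σ^Y`, to let the parameter vary: `v ↦ λ y. a (x :: l, y) ∧ ((∃
    -- y'. R (x, y, y') ∧ v y') ∨ b y)`.
    refine list_ext (lam (lift (lift (fst _ _ ≫ fst _ _) (consAt (fst _ _ ≫ snd _ _ ≫ fst _ _)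
      (fst _ _ ≫ snd _ _ ≫ snd _ _ ≫ fst _ _))) (snd _ _) ≫ a ⊓
      (exi (lift (lift (fst _ Y ≫ fst _ _ ≫ fst _ _) (fst _ _ ≫ fst _ _ ≫ snd _ _ ≫ fst _ _))
          (lift (fst _ _ ≫ snd _ _) (snd _ _)) ≫ R ⊓
          app (fst _ _ ≫ fst _ _ ≫ snd _ _ ≫ snd _ _ ≫ snd _ _) (snd _ _)) ⊔
        lift (fst _ _ ≫ fst _ _) (snd _ _) ≫ b))) ?_ ?_ ?_
    · simpa using congrArg lam (inf_eq_left.2 (hnil (fst Γ Y) (snd Γ Y)))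
    · intro Δ γ x l
      simp only [comp_lam, comp_inf, comp_lift, comp_lift_assoc, lift_fst_assoc, Category.assoc, lift_snd,
        comp_sup, comp_exi, comp_app, lift_snd_assoc, comp_consAt, app_lam, Category.id_comp,
        lift_fst]
      congr 1
      refine le_antisymm (inf_le_inf_left _ le_sup_right) (le_inf inf_le_left ?_)
      refine sup_elim inf_le_right (fun k hk h => ?_) (fun k hk h => h)
      refine exi_elim h fun f z k' hk' hz => ?_
      have h1 := transport hk' (hk.trans inf_le_left)
      simp only [comp_inf, comp_lift, comp_lift_assoc, lift_fst_assoc, lift_snd,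
        comp_consAt, le_inf_iff] at h1 hz ⊢
      exact hcons _ _ _ _ _ _ h1 hz.1 hz.2.2
    · intro Δ γ x l
      simp only [comp_lam, comp_inf, comp_lift, comp_lift_assoc, lift_fst_assoc, Category.assoc, lift_snd,
        comp_sup, comp_exi, comp_app, lift_snd_assoc, comp_consAt, app_lam, Category.id_comp,
        lift_fst]
      congr 1
      refine (inf_eq_left.2 (le_trans ?_ le_sup_left)).symm
      simpa using htail (fst Δ Y ≫ γ) (fst Δ Y ≫ x) (fst Δ Y ≫ l) (snd Δ Y)
  have := congrArg (fun φ => app (lift (𝟙 Γ) l ≫ φ) y) this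
  simp only [comp_lam, app_lam, comp_lift_assoc, comp_inf, lift_fst_assoc, lift_snd,
    Category.id_comp, lift_fst, Category.assoc] at this
  exact inf_eq_left.1 this

end Lists

/-! ### Bounded quantifiers, membership and the Scott principle. -/

section BoundedQuantifiers

variable {C : Type u} [Category.{v} C] [CartesianMonoidalCategory C]

lemma whiskerLeft_comp_eq_lift {X Y Z W : C} (g : Y ⟶ Z) (t : X ⊗ Z ⟶ W) :
    X ◁ g ≫ t = lift (fst X Y) (snd X Y ≫ g) ≫ t := by
  congr 1; ext <;> simp

section

variable [SierpinskiCategory C] {M : C}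

@[simp] lemma comp_eqN [OvertDiscrete M] {Δ Γ : C} (f : Δ ⟶ Γ) (x y : Γ ⟶ M) :
    f ≫ eqN x y = eqN (f ≫ x) (f ≫ y) := by simp [eqN]

@[simp] lemma eqN_self [OvertDiscrete M] {Γ : C} (x : Γ ⟶ M) : eqN x x = ⊤ :=
  (OvertDiscrete.eq_eq_top_iff x x).2 rfl

variable [ListObject M]

@[simp] lemma comp_forallIn {Δ Γ : C} (f : Δ ⟶ Γ) (l : Γ ⟶ Lst M) (t : Γ ⊗ M ⟶ Sig C) :
    f ≫ forallIn l t = forallIn (f ≫ l) (lift (fst Δ M ≫ f) (snd Δ M) ≫ t) := by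
  simp [forallIn, whiskerLeft_comp_eq_lift]

@[simp] lemma forallIn_nil {Γ : C} (t : Γ ⊗ M ⟶ Sig C) : forallIn (nilAt M Γ) t = ⊤ := by
  simp [forallIn]

@[simp] lemma forallIn_cons {Γ : C} (x : Γ ⟶ M) (l : Γ ⟶ Lst M) (t : Γ ⊗ M ⟶ Sig C) :
    forallIn (consAt x l) t = lift (𝟙 Γ) x ≫ t ⊓ forallIn l t := by
  simp [forallIn]

@[simp] lemma comp_existsIn {Δ Γ : C} (f : Δ ⟶ Γ) (l : Γ ⟶ Lst M) (t : Γ ⊗ M ⟶ Sig C) :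
    f ≫ existsIn l t = existsIn (f ≫ l) (lift (fst Δ M ≫ f) (snd Δ M) ≫ t) := by
  simp [existsIn, whiskerLeft_comp_eq_lift]

@[simp] lemma existsIn_cons {Γ : C} (x : Γ ⟶ M) (l : Γ ⟶ Lst M) (t : Γ ⊗ M ⟶ Sig C) :
    existsIn (consAt x l) t = lift (𝟙 Γ) x ≫ t ⊔ existsIn l t := by
  simp [existsIn]

lemma forallIn_mono {Γ : C} {h : Γ ⟶ Sig C} {l : Γ ⟶ Lst M} {t t' : Γ ⊗ M ⟶ Sig C}
    (H : h ≤ forallIn l t)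
    (K : ∀ {Δ : C} (f : Δ ⟶ Γ) (x : Δ ⟶ M) (k : Δ ⟶ Sig C), k ≤ f ≫ h → k ≤ lift f x ≫ t →
      k ≤ lift f x ≫ t') : h ≤ forallIn l t' := by
  have := list_induction (a := fst Γ (Lst M) ≫ h ⊓
      forallIn (snd Γ (Lst M)) (lift (fst _ M ≫ fst Γ (Lst M)) (snd _ M) ≫ t))
    (b := forallIn (snd Γ (Lst M)) (lift (fst _ M ≫ fst Γ (Lst M)) (snd _ M) ≫ t'))
    (by simp) ?_ ?_
  · have := comp_le_comp (lift (𝟙 Γ) l) this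
    simp at this
    exact (le_inf le_rfl H).trans this
  · intro Δ γ x l
    simp only [comp_inf, lift_fst_assoc, comp_forallIn, lift_snd, forallIn_cons, comp_lift,
      comp_lift_assoc, lift_fst]
    exact inf_le_inf_left _ inf_le_right
  · intro Δ γ x l k h1 h2
    simp at h1 h2 ⊢
    exact ⟨K γ x k h1.1 h1.2.1, h2⟩

variable [OvertDiscrete M]

@[simp] lemma comp_mem {Δ Γ : C} (f : Δ ⟶ Γ) (x : Γ ⟶ M) (l : Γ ⟶ Lst M) :
    f ≫ mem x l = mem (f ≫ x) (f ≫ l) := by simp [mem]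

lemma mem_cons {Γ : C} (y x : Γ ⟶ M) (l : Γ ⟶ Lst M) :
    mem y (consAt x l) = eqN x y ⊔ mem y l := by simp [mem]

lemma mem_head {Γ : C} (x : Γ ⟶ M) (l : Γ ⟶ Lst M) : mem x (consAt x l) = ⊤ := by
  simp [mem_cons]

lemma mem_tail {Γ : C} (y x : Γ ⟶ M) (l : Γ ⟶ Lst M) : mem y l ≤ mem y (consAt x l) := by
  simp [mem_cons]

@[simp] lemma comp_elems {Δ Γ : C} (f : Δ ⟶ Γ) (l : Γ ⟶ Lst M) :
    f ≫ elems l = elems (f ≫ l) := by simp [elems]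

@[simp] lemma app_elems {Γ : C} (l : Γ ⟶ Lst M) (x : Γ ⟶ M) : app (elems l) x = mem x l := by
  simp [elems]

lemma forallIn_mem {Γ : C} (l : Γ ⟶ Lst M) :
    forallIn l (mem (snd Γ M) (fst Γ M ≫ l)) = ⊤ := by
  have := list_induction (Γ := Γ) (a := ⊤) (b := forallIn (snd Γ (Lst M))
      (mem (snd _ M) (fst _ M ≫ snd Γ (Lst M)))) (by simp) (by simp) ?_
  · simpa using comp_le_comp (lift (𝟙 Γ) l) this
  · intro Δ γ x l k _ h
    simp [mem_head] at h ⊢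
    exact forallIn_mono h fun f y k _ hy => by
      simp at hy ⊢
      exact hy.trans (mem_tail _ _ _)

lemma forallIn_intro {Γ : C} {h : Γ ⟶ Sig C} {l : Γ ⟶ Lst M} {t : Γ ⊗ M ⟶ Sig C}
    (K : ∀ {Δ : C} (f : Δ ⟶ Γ) (x : Δ ⟶ M) (k : Δ ⟶ Sig C), k ≤ f ≫ h → k ≤ mem x (f ≫ l) →
      k ≤ lift f x ≫ t) : h ≤ forallIn l t :=
  forallIn_mono (le_top.trans (forallIn_mem l).ge) fun f x k hk hx => K f x k hk (by simpa using hx)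

end

variable [Model C] {M : C} [OvertDiscrete M]

lemma scott_intro {Γ : C} {h : Γ ⟶ Sig C} {Φ : Γ ⟶ pow (pow M)} {ξ : Γ ⟶ pow M}
    (l : Γ ⟶ Lst M) (H : h ≤ app Φ (elems l))
    (K : h ≤ forallIn l (app (fst Γ M ≫ ξ) (snd Γ M))) : h ≤ app Φ ξ := by
  rw [Model.scott M Γ Φ ξ]
  exact exi_intro l (by simpa using ⟨H, K⟩)

lemma scott_elim {Γ : C} {h c : Γ ⟶ Sig C} {Φ : Γ ⟶ pow (pow M)} {ξ : Γ ⟶ pow M}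
    (H : h ≤ app Φ ξ)
    (K : ∀ {Δ : C} (f : Δ ⟶ Γ) (l : Δ ⟶ Lst M) (k : Δ ⟶ Sig C), k ≤ f ≫ h →
      k ≤ app (f ≫ Φ) (elems l) → k ≤ forallIn l (app (fst Δ M ≫ f ≫ ξ) (snd Δ M)) →
      k ≤ f ≫ c) : h ≤ c := by
  rw [Model.scott M Γ Φ ξ] at H
  refine exi_elim H fun f l k hk h' => ?_
  simp at h'
  exact K f l k hk h'.1 h'.2

/-- The Scott principle for evaluation at `x`: since `x ∈ l` and `t` holds throughout `l`, `t` holds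
at `x`. No substitution along the internal equality is needed. -/
lemma forallIn_elim {Γ : C} {h : Γ ⟶ Sig C} {l : Γ ⟶ Lst M} {t : Γ ⊗ M ⟶ Sig C} (x : Γ ⟶ M)
    (H : h ≤ forallIn l t) (Hx : h ≤ mem x l) : h ≤ lift (𝟙 Γ) x ≫ t := by
  have := scott_intro (Φ := lam (app (snd Γ (pow M)) (fst Γ (pow M) ≫ x))) (ξ := lam t) (h := h) l
    (by simpa using Hx) (by simpa using H)
  simpa using this

/-- Induction over a list `l`, with a proposition about sublists of `l`. -/
lemma list_induction_mem {Γ : C} {h : Γ ⟶ Sig C} {b : Γ ⊗ Lst M ⟶ Sig C} (l : Γ ⟶ Lst M)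
    (hnil : h ≤ lift (𝟙 Γ) (nilAt M Γ) ≫ b)
    (hcons : ∀ {Δ : C} (γ : Δ ⟶ Γ) (x : Δ ⟶ M) (l' : Δ ⟶ Lst M) (k : Δ ⟶ Sig C),
      k ≤ γ ≫ h → k ≤ mem x (γ ≫ l) → k ≤ lift γ l' ≫ b → k ≤ lift γ (consAt x l') ≫ b) :
    h ≤ lift (𝟙 Γ) l ≫ b := by
  -- The induction carries the invariant that all members of the current list lie in `l`; it is
  -- inherited by tails.
  have := list_induction (a := fst Γ (Lst M) ≫ h ⊓
    forallIn (snd Γ (Lst M)) (mem (snd _ M) (fst _ M ≫ fst Γ (Lst M) ≫ l))) (b := b)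
    (by simpa using hnil) ?_ ?_
  · have := comp_le_comp (lift (𝟙 Γ) l) this
    simp [forallIn_mem] at this
    exact this
  · intro Δ γ x l
    simp only [comp_inf, lift_fst_assoc, comp_forallIn, lift_snd, forallIn_cons, comp_lift,
      Category.assoc, comp_mem]
    exact inf_le_inf_left _ inf_le_right
  · intro Δ γ x l' k h1 h2
    simp at h1
    exact hcons γ x l' k h1.1 h1.2.1 h2

end BoundedQuantifiers

/-! ### Stability of the operations under substitution. -/

section

variable {C : Type u} [Category.{v} C] [CartesianMonoidalCategory C] {N : C}

lemma le_of_eq_top [SierpinskiCategory C] {Γ : C} {h a : Γ ⟶ Sig C} (e : a = ⊤) : h ≤ a :=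
  e ▸ le_top

@[simp] lemma comp_rel [Model C] {Δ Γ : C} (f : Δ ⟶ Γ) (r : N ⊗ N ⟶ Sig C)
    (n m : Γ ⟶ N) : f ≫ rel r n m = rel r (f ≫ n) (f ≫ m) := by simp [rel]

@[simp] lemma comp_powMeet [SierpinskiCategory C] {Δ Γ X : C} (f : Δ ⟶ Γ) (φ ψ : Γ ⟶ pow X) :
    f ≫ powMeet φ ψ = powMeet (f ≫ φ) (f ≫ ψ) := by simp [powMeet]

@[simp] lemma comp_powJoin [SierpinskiCategory C] {Δ Γ X : C} (f : Δ ⟶ Γ) (φ ψ : Γ ⟶ pow X) :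
    f ≫ powJoin φ ψ = powJoin (f ≫ φ) (f ≫ ψ) := by simp [powJoin]

@[simp] lemma app_powMeet [SierpinskiCategory C] {Γ X : C} (φ ψ : Γ ⟶ pow X) (x : Γ ⟶ X) :
    app (powMeet φ ψ) x = app φ x ⊓ app ψ x := by simp [powMeet]

@[simp] lemma app_powJoin [SierpinskiCategory C] {Γ X : C} (φ ψ : Γ ⟶ pow X) (x : Γ ⟶ X) :
    app (powJoin φ ψ) x = app φ x ⊔ app ψ x := by simp [powJoin]

/-! ### The imposed order -/

namespace ImposedOps

variable (S : ImposedOps N)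

@[simp] lemma comp_zeroAt {Δ Γ : C} (f : Δ ⟶ Γ) : f ≫ S.zeroAt Γ = S.zeroAt Δ := by
  simp [zeroAt]

@[simp] lemma comp_oneAt {Δ Γ : C} (f : Δ ⟶ Γ) : f ≫ S.oneAt Γ = S.oneAt Δ := by
  simp [oneAt]

@[simp] lemma comp_plus {Δ Γ : C} (f : Δ ⟶ Γ) (n m : Γ ⟶ N) :
    f ≫ S.plus n m = S.plus (f ≫ n) (f ≫ m) := by simp [plus]

@[simp] lemma comp_times {Δ Γ : C} (f : Δ ⟶ Γ) (n m : Γ ⟶ N) :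
    f ≫ S.times n m = S.times (f ≫ n) (f ≫ m) := by simp [times]

variable [Model C] [OvertDiscrete N]

@[simp] lemma comp_prod {Δ Γ : C} (f : Δ ⟶ Γ) (l : Γ ⟶ Lst N) :
    f ≫ S.prod l = S.prod (f ≫ l) := by simp [prod]

@[simp] lemma prod_nil {Γ : C} : S.prod (nilAt N Γ) = S.oneAt Γ := by simp [prod]

@[simp] lemma prod_cons {Γ : C} (x : Γ ⟶ N) (l : Γ ⟶ Lst N) :
    S.prod (consAt x l) = S.times x (S.prod l) := by simp [prod, times]

@[simp] lemma comp_ev {Δ Γ : C} (f : Δ ⟶ Γ) (L : Γ ⟶ Lst (Lst N)) :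
    f ≫ S.ev L = S.ev (f ≫ L) := by simp [ev]

@[simp] lemma ev_nil {Γ : C} : S.ev (nilAt (Lst N) Γ) = S.zeroAt Γ := by simp [ev]

@[simp] lemma ev_cons {Γ : C} (l : Γ ⟶ Lst N) (L : Γ ⟶ Lst (Lst N)) :
    S.ev (consAt l L) = S.plus (S.prod l) (S.ev L) := by simp [ev]

end ImposedOps

end

/-! ### Distributive lattice calculus and ideals for the imposed order. -/

section Basis

variable {C : Type u} [Category.{v} C] [CartesianMonoidalCategory C] [Model C] {N : C}

namespace IsLatticeOrder

variable {S : ImposedOps N} {r : N ⊗ N ⟶ Sig C} {Γ : C} {h : Γ ⟶ Sig C} {a b c d : Γ ⟶ N}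

lemma le_trans (hr : IsLatticeOrder S r) (h1 : h ≤ rel r a b) (h2 : h ≤ rel r b c) :
    h ≤ rel r a c := (le_inf h1 h2).trans (hr.trans a b c)

lemma self_le (hr : IsLatticeOrder S r) : h ≤ rel r a a := le_of_eq_top (hr.refl a)

lemma le_times (hr : IsLatticeOrder S r) (h1 : h ≤ rel r a b) (h2 : h ≤ rel r a c) :
    h ≤ rel r a (S.times b c) := (le_inf h1 h2).trans (hr.le_star a b c).le

lemma plus_le (hr : IsLatticeOrder S r) (h1 : h ≤ rel r a c) (h2 : h ≤ rel r b c) :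
    h ≤ rel r (S.plus a b) c := (le_inf h1 h2).trans (hr.add_le a b c).le

lemma times_le_left (hr : IsLatticeOrder S r) : h ≤ rel r (S.times a b) a :=
  (hr.self_le.trans (hr.le_star _ a b).ge).trans inf_le_left

lemma times_le_right (hr : IsLatticeOrder S r) : h ≤ rel r (S.times a b) b :=
  (hr.self_le.trans (hr.le_star _ a b).ge).trans inf_le_right

lemma le_plus_left (hr : IsLatticeOrder S r) : h ≤ rel r a (S.plus a b) :=
  (hr.self_le.trans (hr.add_le a b _).ge).trans inf_le_left

lemma le_plus_right (hr : IsLatticeOrder S r) : h ≤ rel r b (S.plus a b) :=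
  (hr.self_le.trans (hr.add_le a b _).ge).trans inf_le_right

lemma times_mono (hr : IsLatticeOrder S r) (h1 : h ≤ rel r a c) (h2 : h ≤ rel r b d) :
    h ≤ rel r (S.times a b) (S.times c d) :=
  hr.le_times (hr.le_trans hr.times_le_left h1) (hr.le_trans hr.times_le_right h2)

lemma plus_mono (hr : IsLatticeOrder S r) (h1 : h ≤ rel r a c) (h2 : h ≤ rel r b d) :
    h ≤ rel r (S.plus a b) (S.plus c d) :=
  hr.plus_le (hr.le_trans h1 hr.le_plus_left) (hr.le_trans h2 hr.le_plus_right)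

lemma times_comm_le (hr : IsLatticeOrder S r) : h ≤ rel r (S.times a b) (S.times b a) :=
  hr.le_times hr.times_le_right hr.times_le_left

lemma times_plus_le (hr : IsLatticeOrder S r) :
    h ≤ rel r (S.times a (S.plus b c)) (S.plus (S.times a b) (S.times a c)) :=
  le_of_eq_top (hr.distrib a b c)

lemma plus_times_le (hr : IsLatticeOrder S r) :
    h ≤ rel r (S.times (S.plus b c) a) (S.plus (S.times b a) (S.times c a)) :=
  hr.le_trans hr.times_comm_le
    (hr.le_trans hr.times_plus_le (hr.plus_mono hr.times_comm_le hr.times_comm_le))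

lemma times_assoc_le (hr : IsLatticeOrder S r) :
    h ≤ rel r (S.times (S.times a b) c) (S.times a (S.times b c)) :=
  hr.le_times (hr.le_trans hr.times_le_left hr.times_le_left)
    (hr.times_mono hr.times_le_right hr.self_le)

lemma le_times_one (hr : IsLatticeOrder S r) : h ≤ rel r a (S.times a (S.oneAt Γ)) :=
  hr.le_times hr.self_le (le_of_eq_top (hr.le_one a))

end IsLatticeOrder

variable [OvertDiscrete N]

/-! ### Formal sums of products -/

lemma dualBasis_intro {Γ : C} {h : Γ ⟶ Sig C} {L : Γ ⟶ Lst (Lst N)} {Φ : Γ ⟶ pow (pow N)}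
    (K : ∀ {Δ : C} (f : Δ ⟶ Γ) (l : Δ ⟶ Lst N) (k : Δ ⟶ Sig C), k ≤ f ≫ h → k ≤ mem l (f ≫ L) →
      k ≤ app (f ≫ Φ) (elems l)) : h ≤ dualBasis L Φ :=
  forallIn_intro fun f l k hk hl => by simpa using K f l k hk hl

lemma dualBasis_elim {Γ : C} {h : Γ ⟶ Sig C} {L : Γ ⟶ Lst (Lst N)} {Φ : Γ ⟶ pow (pow N)}
    (l : Γ ⟶ Lst N) (H : h ≤ dualBasis L Φ) (Hl : h ≤ mem l L) : h ≤ app Φ (elems l) := by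
  simpa using forallIn_elim l H Hl

@[simp] lemma comp_dualBasis {Δ Γ : C} (f : Δ ⟶ Γ) (L : Γ ⟶ Lst (Lst N))
    (Φ : Γ ⟶ pow (pow N)) : f ≫ dualBasis L Φ = dualBasis (f ≫ L) (f ≫ Φ) := by
  simp [dualBasis]

@[simp] lemma dualBasis_nil {Γ : C} (Φ : Γ ⟶ pow (pow N)) : dualBasis (nilAt _ Γ) Φ = ⊤ := by
  simp [dualBasis]

@[simp] lemma dualBasis_cons {Γ : C} (l : Γ ⟶ Lst N) (L : Γ ⟶ Lst (Lst N))
    (Φ : Γ ⟶ pow (pow N)) : dualBasis (consAt l L) Φ = app Φ (elems l) ⊓ dualBasis L Φ := by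
  simp [dualBasis]

namespace AbstractBasis

variable (B : AbstractBasis N)

/-- `n` belongs to the ideal generated by the products of the lists in `Φ`. -/
def ideal {Γ : C} (Φ : Γ ⟶ pow (pow N)) (n : Γ ⟶ N) : Γ ⟶ Sig C :=
  exi (N := Lst (Lst N)) (rel B.le (fst Γ _ ≫ n) (B.ev (snd Γ _)) ⊓
    dualBasis (snd Γ _) (fst Γ _ ≫ Φ))

@[simp] lemma comp_ideal {Δ Γ : C} (f : Δ ⟶ Γ) (Φ : Γ ⟶ pow (pow N)) (n : Γ ⟶ N) :
    f ≫ B.ideal Φ n = B.ideal (f ≫ Φ) (f ≫ n) := by simp [ideal]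

variable {B} {Γ : C} {h c : Γ ⟶ Sig C} {Φ Ψ : Γ ⟶ pow (pow N)} {n m p q : Γ ⟶ N}

lemma ideal_intro (L : Γ ⟶ Lst (Lst N)) (h1 : h ≤ rel B.le n (B.ev L)) (h2 : h ≤ dualBasis L Φ) :
    h ≤ B.ideal Φ n :=
  exi_intro L (by simpa using ⟨h1, h2⟩)

lemma ideal_elim (H : h ≤ B.ideal Φ n)
    (K : ∀ {Δ : C} (f : Δ ⟶ Γ) (L : Δ ⟶ Lst (Lst N)) (k : Δ ⟶ Sig C), k ≤ f ≫ h →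
      k ≤ rel B.le (f ≫ n) (B.ev L) → k ≤ dualBasis L (f ≫ Φ) → k ≤ f ≫ c) : h ≤ c :=
  exi_elim H fun f L k hk h' => by
    simp at h'
    exact K f L k hk h'.1 h'.2

lemma ideal_zero : h ≤ B.ideal Φ (B.zeroAt Γ) :=
  ideal_intro (nilAt _ Γ) (le_of_eq_top (B.le_isLatticeOrder.zero_le _)) (by simp)

lemma ideal_of_le (h1 : h ≤ rel B.le n m) (h2 : h ≤ B.ideal Φ m) : h ≤ B.ideal Φ n :=
  ideal_elim h2 fun f L k hk h3 h4 => by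
    have := transport hk h1
    simp at this ⊢
    exact ideal_intro L (B.le_isLatticeOrder.le_trans this h3) h4

lemma ideal_mono (H : h ≤ B.ideal Φ n)
    (K : ∀ {Δ : C} (f : Δ ⟶ Γ) (l : Δ ⟶ Lst N) (k : Δ ⟶ Sig C), k ≤ f ≫ h →
      k ≤ app (f ≫ Φ) (elems l) → k ≤ app (f ≫ Ψ) (elems l)) : h ≤ B.ideal Ψ n :=
  ideal_elim H fun f L k hk h3 h4 => by
    simp
    refine ideal_intro L h3 (dualBasis_intro fun g l k' hk' hl => ?_)
    have h5 := transport hk' h4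
    have h6 := transport hk' hk
    simp at h5
    simpa using K (g ≫ f) l k' (by simpa using h6) (by simpa using dualBasis_elim l h5 hl)

lemma ideal_prod (l : Γ ⟶ Lst N) (H : h ≤ app Φ (elems l)) : h ≤ B.ideal Φ (B.prod l) :=
  ideal_intro (consAt l (nilAt _ Γ)) (by simpa using B.le_isLatticeOrder.le_plus_left)
    (by simpa using H)

lemma ideal_plus (hn : h ≤ B.ideal Φ n) (hm : h ≤ B.ideal Φ m) : h ≤ B.ideal Φ (B.plus n m) :=
  ideal_elim hm fun f L k hk h1 h2 => by
    have hn' := transport hk hn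
    simp at hn' ⊢
    refine ideal_elim hn' fun g L' k' hk' h3 h4 => ?_
    replace h1 := transport hk' h1
    replace h2 := transport hk' h2
    simp at h1 h2 ⊢
    -- This replaces concatenation: the members of `L'` are added one at a time to a formal sum that
    -- already bounds `m`.
    have := list_induction_mem (h := k')
      (b := B.ideal (fst _ _ ≫ g ≫ f ≫ Φ) (B.plus (B.ev (snd _ _)) (fst _ _ ≫ g ≫ f ≫ m))) L'
      (by
        simp
        exact ideal_intro (g ≫ L) (B.le_isLatticeOrder.plus_le
          (le_of_eq_top (B.le_isLatticeOrder.zero_le _)) h1) h2)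
      (fun e x l k hk hx hl => by
        replace h4 := transport hk h4
        simp at h4 hl ⊢
        refine ideal_elim hl fun e' L'' k' hk' h5 h6 => ?_
        have h7 := transport hk' (dualBasis_elim x h4 hx)
        simp at h5 h6 h7 ⊢
        refine ideal_intro (consAt (e' ≫ x) L'') ?_ (by simpa using ⟨h7, h6⟩)
        simp
        have hr := B.le_isLatticeOrder
        exact hr.plus_le (hr.plus_mono hr.self_le (hr.le_trans hr.le_plus_left h5))
          (hr.le_trans hr.le_plus_right (hr.le_trans h5 hr.le_plus_right)))
    simp at this
    exact ideal_of_le (B.le_isLatticeOrder.plus_mono h3 B.le_isLatticeOrder.self_le) this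

/-- An ideal that contains `μ l ⋆ n` for each `l ∈ L` contains `ev L ⋆ n`. -/
lemma ideal_ev_times {L : Γ ⟶ Lst (Lst N)}
    (K : ∀ {Δ : C} (f : Δ ⟶ Γ) (l : Δ ⟶ Lst N) (k : Δ ⟶ Sig C), k ≤ f ≫ h →
      k ≤ mem l (f ≫ L) → k ≤ B.ideal (f ≫ Φ) (B.times (B.prod l) (f ≫ n))) :
    h ≤ B.ideal Φ (B.times (B.ev L) n) := by
  have hr := B.le_isLatticeOrder
  have := list_induction_mem (h := h)
      (b := B.ideal (fst _ _ ≫ Φ) (B.times (B.ev (snd _ _)) (fst _ _ ≫ n))) L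
      (by simpa using ideal_of_le hr.times_le_left ideal_zero)
      (fun e x l k hk hx hl => by
        simp at hl ⊢
        exact ideal_of_le hr.plus_times_le (ideal_plus (K e x k hk hx) hl))
  simpa using this

/-- Induction on `l` gives a list `l₂` that contains `l` and `l'` and has `μ l ⋆ μ l' ≼ μ l₂`. By
monotonicity both predicates hold at `l₂`. -/
lemma ideal_prod_times_prod (l l' : Γ ⟶ Lst N) (H : h ≤ app Φ (elems l))
    (H' : h ≤ app Ψ (elems l')) :
    h ≤ B.ideal (powMeet Φ Ψ) (B.times (B.prod l) (B.prod l')) := by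
  have hr := B.le_isLatticeOrder
  have := list_induction_mem (h := h) (b := exi (N := Lst N)
    (rel B.le (B.times (B.prod (fst _ _ ≫ snd _ _)) (fst _ _ ≫ fst _ _ ≫ B.prod l'))
        (B.prod (snd _ _)) ⊓
      (forallIn (fst _ _ ≫ snd _ _) (mem (snd _ _) (fst _ _ ≫ snd _ _)) ⊓
      forallIn (fst _ _ ≫ fst _ _ ≫ l') (mem (snd _ _) (fst _ _ ≫ snd _ _))))) l
    (by
      simp
      refine exi_intro l' ?_
      simp [forallIn_mem]
      exact hr.times_le_right)
    (fun e x l₁ k hk hx hl => by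
      simp at hl ⊢
      refine exi_elim hl fun f l₂ k₂ hk₂ h' => ?_
      simp at h' ⊢
      refine exi_intro (consAt (f ≫ x) l₂) ?_
      simp [mem_head]
      refine ⟨hr.le_trans hr.times_assoc_le (hr.times_mono hr.self_le h'.1),
        forallIn_mono h'.2.1 fun g y k _ hy => ?_, forallIn_mono h'.2.2 fun g y k _ hy => ?_⟩
      all_goals
        simp at hy ⊢
        exact hy.trans (mem_tail _ _ _))
  simp at this
  refine exi_elim this fun f l₂ k hk h' => ?_
  simp at h' ⊢
  have H₁ := transport hk H
  have H₂ := transport hk H'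
  simp at H₁ H₂
  refine ideal_of_le h'.1 (ideal_prod l₂ ?_)
  simp
  refine ⟨app_mono H₁ fun g y k' hk' hy => ?_, app_mono H₂ fun g y k' hk' hy => ?_⟩
  · have h₃ := transport hk' h'.2.1
    simp at h₃ hy ⊢
    simpa using forallIn_elim y h₃ hy
  · have h₃ := transport hk' h'.2.2
    simp at h₃ hy ⊢
    simpa using forallIn_elim y h₃ hy

/-- Distributivity expands each factor as a sum of products in turn, which reduces the claim to a
product of two products. -/
lemma ideal_times (hn : h ≤ B.ideal Φ n) (hm : h ≤ B.ideal Ψ m) :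
    h ≤ B.ideal (powMeet Φ Ψ) (B.times n m) := by
  have hr := B.le_isLatticeOrder
  refine ideal_elim hn fun f L k hk h1 h2 => ?_
  replace hm := transport hk hm
  simp at hm ⊢
  refine ideal_of_le (hr.times_mono h1 hr.self_le) (ideal_ev_times fun g l k' hk' hl => ?_)
  replace hm := transport hk' hm
  replace h2 := transport hk' h2
  simp at hm h2 ⊢
  replace h2 := dualBasis_elim l h2 hl
  refine ideal_elim hm fun f' L' k₂ hk₂ h3 h4 => ?_
  replace h2 := transport hk₂ h2
  simp at h2 h3 h4 ⊢
  refine ideal_of_le (hr.le_trans (hr.times_mono hr.self_le h3) hr.times_comm_le)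
    (ideal_ev_times fun g' l' k₃ hk₃ hl' => ?_)
  replace h2 := transport hk₃ h2
  replace h4 := transport hk₃ h4
  simp at h2 h4 ⊢
  exact ideal_of_le hr.times_comm_le (ideal_prod_times_prod _ _ h2 (dualBasis_elim l' h4 hl'))

end AbstractBasis

end Basis

/-! ### The covering relation, and the equations for meets and joins. -/

section Nucleus

variable {C : Type u} [Category.{v} C] [CartesianMonoidalCategory C] [Model C] {N : C}
  [OvertDiscrete N]

namespace AbstractBasis

variable (B : AbstractBasis N)

/-- `∃ L. (n ≪ ev L) ∧ 𝒜_L Φ` -/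
def covered {Γ : C} (Φ : Γ ⟶ pow (pow N)) (n : Γ ⟶ N) : Γ ⟶ Sig C :=
  exi (N := Lst (Lst N)) (rel B.wb (fst Γ _ ≫ n) (B.ev (snd Γ _)) ⊓
    dualBasis (snd Γ _) (fst Γ _ ≫ Φ))

@[simp] lemma comp_covered {Δ Γ : C} (f : Δ ⟶ Γ) (Φ : Γ ⟶ pow (pow N)) (n : Γ ⟶ N) :
    f ≫ B.covered Φ n = B.covered (f ≫ Φ) (f ≫ n) := by simp [covered]

@[simp] lemma comp_nucleusAt {Δ Γ : C} (f : Δ ⟶ Γ) (Φ : Γ ⟶ pow (pow N)) (ξ : Γ ⟶ pow N) :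
    f ≫ B.nucleusAt Φ ξ = B.nucleusAt (f ≫ Φ) (f ≫ ξ) := by simp [nucleusAt]

@[simp] lemma app_nucleus {Γ : C} (Φ : Γ ⟶ pow (pow N)) (ξ : Γ ⟶ pow N) :
    app (Φ ≫ B.nucleus) ξ = B.nucleusAt Φ ξ := by
  simp [nucleus]

variable {B} {Γ : C} {h c : Γ ⟶ Sig C} {Φ Ψ : Γ ⟶ pow (pow N)} {n m p q : Γ ⟶ N}
  {ξ : Γ ⟶ pow N}

/-! ### The way-below relation -/

lemma wb_of_wb_of_le (h1 : h ≤ rel B.wb n m) (h2 : h ≤ rel B.le m p) : h ≤ rel B.wb n p :=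
  (le_inf (le_inf B.le_isLatticeOrder.self_le h1) h2).trans (B.wb_mono n n m p)

lemma wb_trans (h1 : h ≤ rel B.wb n m) (h2 : h ≤ rel B.wb m p) : h ≤ rel B.wb n p := by
  rw [B.interpolation]
  exact exi_intro m (by simpa using ⟨h1, h2⟩)

lemma wb_elim (H : h ≤ rel B.wb n p)
    (K : ∀ {Δ : C} (f : Δ ⟶ Γ) (m : Δ ⟶ N) (k : Δ ⟶ Sig C), k ≤ f ≫ h →
      k ≤ rel B.wb (f ≫ n) m → k ≤ rel B.wb m (f ≫ p) → k ≤ f ≫ c) : h ≤ c := by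
  rw [B.interpolation] at H
  refine exi_elim H fun f m k hk h' => ?_
  simp at h'
  exact K f m k hk h'.1 h'.2

lemma wilker_elim (H : h ≤ rel B.wb n (B.plus p q))
    (K : ∀ {Δ : C} (f : Δ ⟶ Γ) (p' q' : Δ ⟶ N) (k : Δ ⟶ Sig C), k ≤ f ≫ h →
      k ≤ rel B.wb (f ≫ n) (B.plus p' q') → k ≤ rel B.wb p' (f ≫ p) → k ≤ rel B.wb q' (f ≫ q) →
      k ≤ f ≫ c) : h ≤ c := by
  rw [B.wilker] at H
  refine exi_elim H fun f p' k hk h' => ?_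
  simp at h'
  refine exi_elim h' fun g q' k' hk' h'' => ?_
  simp at h''
  have := transport hk' hk
  simpa using K (g ≫ f) (g ≫ p') q' k' (by simpa using this) (by simpa using h''.1.1)
    (by simpa using h''.1.2) (by simpa using h''.2)

/-! ### Covered elements -/

lemma covered_intro (h1 : h ≤ rel B.wb n m) (h2 : h ≤ B.ideal Φ m) : h ≤ B.covered Φ n :=
  ideal_elim h2 fun f L k hk h3 h4 => by
    have := transport hk h1
    simp at this ⊢
    exact exi_intro L (by simpa using ⟨wb_of_wb_of_le this h3, h4⟩)

lemma covered_elim (H : h ≤ B.covered Φ n)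
    (K : ∀ {Δ : C} (f : Δ ⟶ Γ) (m : Δ ⟶ N) (k : Δ ⟶ Sig C), k ≤ f ≫ h →
      k ≤ rel B.wb (f ≫ n) m → k ≤ B.ideal (f ≫ Φ) m → k ≤ f ≫ c) : h ≤ c :=
  exi_elim H fun f L k hk h' => by
    simp at h'
    exact K f (B.ev L) k hk h'.1 (ideal_intro L B.le_isLatticeOrder.self_le h'.2)

lemma covered_of_wb (h1 : h ≤ rel B.wb n m) (h2 : h ≤ B.covered Φ m) : h ≤ B.covered Φ n :=
  covered_elim h2 fun f q k hk h3 h4 => by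
    have := transport hk h1
    simp at this ⊢
    exact covered_intro (wb_trans this h3) h4

lemma covered_mono (H : h ≤ B.covered Φ n)
    (K : ∀ {Δ : C} (f : Δ ⟶ Γ) (l : Δ ⟶ Lst N) (k : Δ ⟶ Sig C), k ≤ f ≫ h →
      k ≤ app (f ≫ Φ) (elems l) → k ≤ app (f ≫ Ψ) (elems l)) : h ≤ B.covered Ψ n :=
  covered_elim H fun f m k hk h1 h2 => by
    simp
    refine covered_intro h1 (ideal_mono h2 fun g l k' hk' hl => ?_)
    have := transport hk' hk
    simpa using K (g ≫ f) l k' (by simpa using this) (by simpa using hl)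

lemma covered_of_wb_plus (h1 : h ≤ rel B.wb n (B.plus p q)) (hp : h ≤ B.covered Φ p)
    (hq : h ≤ B.covered Φ q) : h ≤ B.covered Φ n :=
  covered_elim hp fun f p' k hk h2 h3 => by
    replace hq := transport hk hq
    simp at hq ⊢
    refine covered_elim hq fun g q' k' hk' h4 h5 => ?_
    replace h1 := transport hk' (transport hk h1)
    replace h2 := transport hk' h2
    replace h3 := transport hk' h3
    simp at h1 h2 h3 ⊢
    have hr := B.le_isLatticeOrder
    refine covered_intro (wb_trans h1 ?_) (ideal_plus h3 h5)
    rw [← B.add_wb]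
    exact le_inf (wb_of_wb_of_le h2 hr.le_plus_left) (wb_of_wb_of_le h4 hr.le_plus_right)

lemma covered_of_wb_prod (l : Γ ⟶ Lst N) (h1 : h ≤ rel B.wb n (B.prod l))
    (h2 : h ≤ app Φ (elems l)) : h ≤ B.covered Φ n :=
  covered_intro h1 (ideal_prod l h2)

lemma covered_of_wb_singleton (h1 : h ≤ rel B.wb n m)
    (h2 : h ≤ app Φ (elems (consAt m (nilAt N Γ)))) : h ≤ B.covered Φ n :=
  covered_of_wb_prod _ (wb_of_wb_of_le h1 (by simpa using B.le_isLatticeOrder.le_times_one)) h2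

/-- From `m ≪ p` and `m ≪ q`, with `p` and `q` in the two ideals, the `⋆` rule gives `n ≪ p ⋆ q`
only for `n ≪ m`; later uses make this room by interpolation. -/
lemma covered_powMeet (h1 : h ≤ rel B.wb n m) (h2 : h ≤ B.covered Φ m)
    (h3 : h ≤ B.covered Ψ m) : h ≤ B.covered (powMeet Φ Ψ) n :=
  covered_elim h2 fun f p k hk h4 h5 => by
    replace h3 := transport hk h3
    simp at h3 ⊢
    refine covered_elim h3 fun g q k' hk' h6 h7 => ?_
    replace h1 := transport hk' (transport hk h1)
    replace h4 := transport hk' h4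
    replace h5 := transport hk' h5
    simp at h1 h4 h5 ⊢
    exact covered_intro ((le_inf (le_inf h1 h4) h6).trans (B.wb_star _ _ _ _)) (ideal_times h5 h7)

/-- Repeated use of the Wilker rule breaks `n ≪ ev L` into pieces, each way below a single product,
and `covered_of_wb_plus` reassembles them. -/
lemma covered_of_wb_ev {L : Γ ⟶ Lst (Lst N)} (h1 : h ≤ rel B.wb n (B.ev L))
    (h2 : h ≤ dualBasis L Φ)
    (K : ∀ {Δ : C} (f : Δ ⟶ Γ) (l : Δ ⟶ Lst N) (p : Δ ⟶ N) (k : Δ ⟶ Sig C), k ≤ f ≫ h →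
      k ≤ rel B.wb p (B.prod l) → k ≤ app (f ≫ Φ) (elems l) → k ≤ B.covered (f ≫ Ψ) p) :
    h ≤ B.covered Ψ n := by
  -- The parameter is the element still to be covered. `R` says that `y ≪ p + y'` for some `p ≪ μ
  -- x`, so peeling off the head `x` leaves `y'`.
  have := list_induction_param (Γ := Γ) (M := Lst N) (Y := N)
    (a := fst _ _ ≫ fst _ _ ≫ h ⊓ (dualBasis (fst _ _ ≫ snd _ _) (fst _ _ ≫ fst _ _ ≫ Φ) ⊓
      rel B.wb (snd _ _) (B.ev (fst _ _ ≫ snd _ _))))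
    (b := B.covered (fst _ _ ≫ Ψ) (snd _ _))
    (exi (N := N) (rel B.wb (fst _ _ ≫ snd _ _ ≫ fst _ _)
      (B.plus (snd _ _) (fst _ _ ≫ snd _ _ ≫ snd _ _)) ⊓
      rel B.wb (snd _ _) (B.prod (fst _ _ ≫ fst _ _ ≫ snd _ _))))
    ?_ ?_ ?_ L n
  · simp at this
    exact (le_inf le_rfl (le_inf h2 h1)).trans this
  · intro Δ γ y
    simp
    exact covered_intro inf_le_right ideal_zero
  · intro Δ γ x l y
    simp
    refine wilker_elim (inf_le_right.trans inf_le_right) fun f p q k hk h3 h4 h5 => ?_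
    simp at hk h3 h4 h5 ⊢
    refine exi_intro q ?_
    simp
    exact ⟨exi_intro p (by simpa using ⟨h3, h4⟩), hk.1, hk.2.1.2, h5⟩
  · intro Δ γ x l y y' k h3 h4 h5
    simp at h3 h4 h5 ⊢
    refine exi_elim h4 fun f p k' hk' h6 => ?_
    replace h3 := transport hk' (le_inf h3.1 h3.2.1.1)
    replace h5 := transport hk' h5
    simp at h3 h5 h6 ⊢
    have h7 := K (f ≫ γ) (f ≫ x) p k' (by simpa using h3.1) h6.2 (by simpa using h3.2)
    exact covered_of_wb_plus h6.1 (by simpa using h7) h5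

/-- To compare the elements covered by two predicates, it is enough to consider those that are
way below the product of a single list. -/
lemma covered_le_covered (H : h ≤ B.covered Φ n)
    (K : ∀ {Δ : C} (f : Δ ⟶ Γ) (l : Δ ⟶ Lst N) (p : Δ ⟶ N) (k : Δ ⟶ Sig C), k ≤ f ≫ h →
      k ≤ rel B.wb p (B.prod l) → k ≤ app (f ≫ Φ) (elems l) → k ≤ B.covered (f ≫ Ψ) p) :
    h ≤ B.covered Ψ n := by
  refine exi_elim H fun γ L k hk h' => ?_
  simp at h' ⊢
  refine covered_of_wb_ev h'.1 h'.2 fun f l p k' hk' h1 h2 => ?_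
  have := transport hk' hk
  simpa using K (f ≫ γ) l p k' (by simpa using this) h1 (by simpa using h2)

/-! ### The nucleus -/

lemma nucleusAt_intro (n : Γ ⟶ N) (h1 : h ≤ app ξ n) (h2 : h ≤ B.covered Φ n) :
    h ≤ B.nucleusAt Φ ξ := by
  refine exi_elim h2 fun f L k hk h' => ?_
  replace h1 := transport hk h1
  simp at h1 h' ⊢
  exact exi_intro (f ≫ n) (by simpa using exi_intro L (by simpa using ⟨⟨h1, h'.1⟩, h'.2⟩))

lemma nucleusAt_elim (H : h ≤ B.nucleusAt Φ ξ)
    (K : ∀ {Δ : C} (f : Δ ⟶ Γ) (n : Δ ⟶ N) (k : Δ ⟶ Sig C), k ≤ f ≫ h →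
      k ≤ app (f ≫ ξ) n → k ≤ B.covered (f ≫ Φ) n → k ≤ f ≫ c) : h ≤ c := by
  refine exi_elim H fun f n k hk h' => ?_
  simp at h'
  refine exi_elim h' fun g L k' hk' h'' => ?_
  simp at h''
  have h1 := transport hk' hk
  have h2 : k' ≤ B.covered (g ≫ f ≫ Φ) (g ≫ n) :=
    exi_intro L (by simpa using ⟨h''.1.2, h''.2⟩)
  simpa using K (g ≫ f) (g ≫ n) k' (by simpa using h1) (by simpa using h''.1.1)
    (by simpa using h2)

lemma nucleusAt_mono (H : h ≤ B.nucleusAt Φ ξ)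
    (K : ∀ {Δ : C} (f : Δ ⟶ Γ) (l : Δ ⟶ Lst N) (p : Δ ⟶ N) (k : Δ ⟶ Sig C), k ≤ f ≫ h →
      k ≤ rel B.wb p (B.prod l) → k ≤ app (f ≫ Φ) (elems l) → k ≤ B.covered (f ≫ Ψ) p) :
    h ≤ B.nucleusAt Ψ ξ :=
  nucleusAt_elim H fun f n k hk h1 h2 => by
    simp
    refine nucleusAt_intro n h1 (covered_le_covered h2 fun g l p k' hk' h3 h4 => ?_)
    have := transport hk' hk
    simpa using K (g ≫ f) l p k' (by simpa using this) h3 (by simpa using h4)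

lemma prod_le_of_mem (l : Γ ⟶ Lst N) (H : h ≤ mem n l) : h ≤ rel B.le (B.prod l) n := by
  have hr := B.le_isLatticeOrder
  have := list_induction_mem (h := h) (b := forallIn (snd _ _)
    (rel B.le (B.prod (fst _ _ ≫ snd _ _)) (snd _ _))) l (by simp)
    (fun e x l k hk hx hl => by
      simp at hl ⊢
      refine ⟨hr.times_le_left, forallIn_mono hl fun f y k' hk' hy => ?_⟩
      simp at hy ⊢
      exact hr.le_trans hr.times_le_right hy)
  simp at this
  simpa using forallIn_elim n this H

/-- Some member `m` of `l` is covered by `Φ`, and `n ≪ μ l ≼ m`. -/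
lemma nucleusAt_elems (l : Γ ⟶ Lst N) (h1 : h ≤ rel B.wb n (B.prod l))
    (h2 : h ≤ B.nucleusAt Φ (elems l)) : h ≤ B.covered Φ n :=
  nucleusAt_elim h2 fun f m k hk h3 h4 => by
    replace h1 := transport hk h1
    simp at h1 h3 ⊢
    exact covered_of_wb (wb_of_wb_of_le h1 (prod_le_of_mem _ h3)) h4

lemma nucleusAt_singleton (l : Γ ⟶ Lst N) (h1 : h ≤ rel B.wb n (B.prod l))
    (h2 : h ≤ app Φ (elems l)) : h ≤ B.nucleusAt Φ (elems (consAt n (nilAt N Γ))) :=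
  nucleusAt_intro n (by simp [mem_head]) (covered_of_wb_prod l h1 h2)

theorem nucleus_powMeet (Φ Ψ : Γ ⟶ pow (pow N)) :
    powMeet Φ Ψ ≫ B.nucleus = powMeet (Φ ≫ B.nucleus) (Ψ ≫ B.nucleus) ≫ B.nucleus := by
  refine pow_ext fun f ξ => ?_
  rw [← Category.assoc, ← Category.assoc, app_nucleus, app_nucleus]
  simp only [comp_powMeet]
  refine le_antisymm (nucleusAt_mono le_rfl fun g l p k hk h1 h2 => ?_)
    (nucleusAt_mono le_rfl fun g l p k hk h1 h2 => ?_)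
  · simp at h2
    -- Interpolation gives `p ≪ q ≪ μ l`: the second half puts `{q}` in `E Φ` and in `E Ψ`, and the
    -- first lets the singleton `{q}` cover `p`.
    refine wb_elim h1 fun e q k' hk' h3 h4 => ?_
    replace h2 := transport hk' (le_inf h2.1 h2.2)
    simp at h2 h4 ⊢
    refine covered_of_wb_singleton h3 ?_
    simp only [← Category.assoc, app_powMeet, app_nucleus]
    exact le_inf (nucleusAt_singleton (e ≫ l) h4 (by simpa using h2.1))
      (nucleusAt_singleton (e ≫ l) h4 (by simpa using h2.2))
  · simp only [← Category.assoc, app_powMeet, app_nucleus, comp_powMeet] at h2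
    refine wb_elim h1 fun e q k' hk' h3 h4 => ?_
    replace h2 := transport hk' h2
    simp at h2 h4 ⊢
    exact covered_powMeet h3 (nucleusAt_elems _ h4 h2.1) (nucleusAt_elems _ h4 h2.2)

theorem nucleus_powJoin (Φ Ψ : Γ ⟶ pow (pow N)) :
    powJoin Φ Ψ ≫ B.nucleus = powJoin (Φ ≫ B.nucleus) (Ψ ≫ B.nucleus) ≫ B.nucleus := by
  refine pow_ext fun f ξ => ?_
  rw [← Category.assoc, ← Category.assoc, app_nucleus, app_nucleus]
  simp only [comp_powJoin]
  refine le_antisymm (nucleusAt_mono le_rfl fun g l p k hk h1 h2 => ?_)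
    (nucleusAt_mono le_rfl fun g l p k hk h1 h2 => ?_)
  · refine wb_elim h1 fun e q k' hk' h3 h4 => ?_
    replace h2 := transport hk' h2
    simp at h2 h4 ⊢
    refine covered_of_wb_singleton h3 ?_
    simp only [← Category.assoc, app_powJoin, app_nucleus]
    refine sup_elim h2 (fun j hj h5 => ?_) (fun j hj h5 => ?_)
    · exact (nucleusAt_singleton (e ≫ l) (hj.trans h4) (by simpa using h5)).trans le_sup_left
    · exact (nucleusAt_singleton (e ≫ l) (hj.trans h4) (by simpa using h5)).trans le_sup_right
  · simp only [← Category.assoc, app_powJoin, app_nucleus, comp_powJoin] at h2 ⊢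
    refine sup_elim h2 (fun j hj h5 => ?_) (fun j hj h5 => ?_)
    · exact covered_mono (nucleusAt_elems _ (hj.trans h1) h5) fun e l' k' hk' h6 => by
        simp at h6 ⊢
        exact h6.trans le_sup_left
    · exact covered_mono (nucleusAt_elems _ (hj.trans h1) h5) fun e l' k' hk' h6 => by
        simp at h6 ⊢
        exact h6.trans le_sup_right

end AbstractBasis

end Nucleus

/-! ### Finite meets of basic predicates, and the nucleus equation. -/

section Nucleus

variable {C : Type u} [Category.{v} C] [CartesianMonoidalCategory C] [Model C] {N : C}
  [OvertDiscrete N]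

/-- The basic predicate `λ ξ. ∃ l ∈ L. ∀ n ∈ l. ξ n`. -/
def basicOpen {Γ : C} (L : Γ ⟶ Lst (Lst N)) : Γ ⟶ pow (pow N) :=
  lam (exi (N := Lst N) (mem (snd _ _) (fst _ _ ≫ fst _ _ ≫ L) ⊓
    forallIn (snd _ _) (app (fst _ _ ≫ fst _ _ ≫ snd _ _) (snd _ _))))

@[simp] lemma comp_basicOpen {Δ Γ : C} (f : Δ ⟶ Γ) (L : Γ ⟶ Lst (Lst N)) :
    f ≫ basicOpen L = basicOpen (f ≫ L) := by simp [basicOpen]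

lemma dualBasis_basicOpen {Γ : C} {h : Γ ⟶ Sig C} (L : Γ ⟶ Lst (Lst N)) :
    h ≤ dualBasis L (basicOpen L) :=
  dualBasis_intro fun f l k hk hl => by
    simp [basicOpen]
    exact exi_intro l (by simpa [forallIn_mem] using hl)

/-- With `dualBasis_basicOpen`, this makes `basicOpen L` the least `Φ` for which `𝒜_L Φ` holds. -/
lemma app_of_basicOpen {Γ : C} {h : Γ ⟶ Sig C} {L : Γ ⟶ Lst (Lst N)} {Φ : Γ ⟶ pow (pow N)}
    {ξ : Γ ⟶ pow N} (h1 : h ≤ dualBasis L Φ) (h2 : h ≤ app (basicOpen L) ξ) : h ≤ app Φ ξ := by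
  simp [basicOpen] at h2
  refine exi_elim h2 fun f l k hk h' => ?_
  replace h1 := transport hk h1
  simp at h1 h' ⊢
  exact scott_intro l (dualBasis_elim l h1 h'.1) h'.2

namespace AbstractBasis

variable {B : AbstractBasis N} {Γ : C} {h c : Γ ⟶ Sig C} {p q : Γ ⟶ N}

/-- Each binary meet uses up one interpolation step. The invariant keeps some `m` with `p ≪ m ≪ q`
that is covered by the meet so far, which leaves room below `m` for the next step. -/
lemma covered_forallIn {M : C} [OvertDiscrete M] {l : Γ ⟶ Lst M} {Φ : Γ ⊗ M ⟶ pow (pow N)}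
    (h1 : h ≤ rel B.wb p q) (h2 : h ≤ forallIn l (B.covered Φ (fst _ _ ≫ q))) :
    h ≤ B.covered (lam (forallIn (fst _ _ ≫ l)
      (app (lift (fst _ _ ≫ fst _ _) (snd _ _) ≫ Φ) (fst _ _ ≫ snd _ _)))) p := by
  have := list_induction_mem (h := h) (b := exi (N := N)
    (rel B.wb (fst _ _ ≫ fst _ _ ≫ p) (snd _ _) ⊓ (rel B.wb (snd _ _) (fst _ _ ≫ fst _ _ ≫ q) ⊓
      B.covered (lam (forallIn (fst _ _ ≫ fst _ _ ≫ snd _ _)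
        (app (lift (fst _ _ ≫ fst _ _ ≫ fst _ _ ≫ fst _ _) (snd _ _) ≫ Φ) (fst _ _ ≫ snd _ _))))
        (snd _ _)))) l ?_ ?_
  · simp at this
    refine exi_elim this fun f m k hk h' => ?_
    simp at h' ⊢
    exact covered_of_wb h'.1 h'.2.2
  · simp
    refine wb_elim h1 fun f m k hk h3 h4 => ?_
    simp
    exact exi_intro m (by
      simp
      exact ⟨h3, h4, covered_of_wb_singleton h4 (by simp)⟩)
  · intro Δ γ x l' k hk hx hl
    simp at hl ⊢
    refine exi_elim hl fun f m k' hk' h' => ?_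
    simp at h' ⊢
    refine wb_elim h'.1 fun g m' k₂ hk₂ h3 h4 => ?_
    have h5 := transport hk₂ h'.2.1
    have h6 := transport hk₂ h'.2.2
    have h7 := transport hk₂ (transport hk' (transport hk h2))
    have h8 := transport hk₂ (transport hk' hx)
    simp at h3 h5 h6 h7 h8 ⊢
    have h9 := forallIn_elim _ h7 h8
    simp at h9
    refine exi_intro m' ?_
    simp
    refine ⟨h3, wb_trans h4 h5, covered_mono (covered_powMeet h4 (covered_of_wb h5 h9) h6) ?_⟩
    intro Θ e y k₃ hk₃ hy
    simpa using hy

/-- Scott continuity of `F`, combined with closure of covered elements under finite meets. -/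
lemma covered_of_app_covered {F : Γ ⟶ pow (pow (pow (pow N)))} (h1 : h ≤ rel B.wb p q)
    (h2 : h ≤ app F (lam (B.covered (snd _ _) (fst _ _ ≫ q)))) :
    h ≤ B.covered (lam (app (fst _ _ ≫ F) (lam (app (snd _ _) (fst _ _ ≫ snd _ _))))) p := by
  -- The hypothesis is read as a predicate on sets of formal sums, evaluated at `{L | q ≪ ev L}`, so
  -- that the Scott principle applies to that set.
  have h3 : h ≤ app (Γ := Γ) (X := pow (Lst (Lst N)))
      (lam (app (fst _ _ ≫ F) (lam (exi (N := Lst (Lst N))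
        (app (fst _ _ ≫ fst _ _ ≫ snd _ _) (snd _ _) ⊓ dualBasis (snd _ _) (fst _ _ ≫ snd _ _))))))
      (lam (rel B.wb (fst _ _ ≫ q) (B.ev (snd _ _)))) := by
    simpa [covered] using h2
  refine scott_elim h3 fun f 𝓛 k hk h4 h5 => ?_
  replace h1 := transport hk h1
  simp at h1 h4 h5 ⊢
  -- The meet of `basicOpen L` over `L ∈ 𝓛` covers `p`, since each `L ∈ 𝓛` has `q ≪ ev L`. What
  -- remains is that this meet implies `F (λ φ. φ x)`.
  refine covered_mono (covered_forallIn (Φ := basicOpen (snd _ _)) h1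
    (forallIn_mono h5 fun g L k' hk' hL => ?_)) fun g l k' hk' hl => ?_
  · simp at hL ⊢
    exact exi_intro L (by simpa using ⟨hL, dualBasis_basicOpen L⟩)
  · replace h4 := transport hk' h4
    simp at h4 hl ⊢
    refine app_mono h4 fun e φ k₂ hk₂ hφ => ?_
    simp at hφ ⊢
    refine exi_elim hφ fun e' L k₃ hk₃ hL => ?_
    have := transport hk₃ (transport hk₂ hl)
    simp at hL this ⊢
    exact app_of_basicOpen hL.2 (by simpa using forallIn_elim L this hL.1)

theorem nucleus_isNucleus (B : AbstractBasis N) : IsNucleus B.nucleus := by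
  intro Γ F
  refine pow_ext fun f ξ => ?_
  rw [← Category.assoc, ← Category.assoc, app_nucleus, app_nucleus]
  refine le_antisymm (nucleusAt_mono le_rfl fun g l p k hk h1 h2 => ?_)
    (nucleusAt_mono le_rfl fun g l p k hk h1 h2 => ?_)
  · refine wb_elim h1 fun e q k' hk' h3 h4 => ?_
    replace h2 := transport hk' h2
    simp at h2 h4 ⊢
    refine covered_of_wb_singleton h3 ?_
    simp
    refine app_mono h2 fun e' φ k₂ hk₂ hφ => ?_
    replace h4 := transport hk₂ h4
    simp at h4 hφ ⊢
    exact nucleusAt_singleton _ h4 hφ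
  · refine wb_elim h1 fun e q k' hk' h3 h4 => ?_
    replace h2 := transport hk' h2
    simp at h2 h4 ⊢
    -- Under `q ≪ μ l`, the truth of `E φ` at `l` makes `φ` cover `q`, so `F` may be evaluated at
    -- the covering predicate instead.
    have := covered_of_app_covered h3 (app_mono h2 (ψ := lam (B.covered (snd _ _) (fst _ _ ≫ q)))
      fun e' φ k₂ hk₂ hφ => by
        replace h4 := transport hk₂ h4
        simp at h4 hφ ⊢
        exact nucleusAt_elems _ h4 hφ)
    simpa using this

end AbstractBasis

end Nucleus

end ASD

theorem mainTheorem5 {C : Type u} [CategoryTheory.Category.{v} C]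
    [CategoryTheory.CartesianMonoidalCategory C] [ASD.Model C]
    (N : C) [ASD.OvertDiscrete N] (B : ASD.AbstractBasis N) :
    ASD.IsNucleus (X := ASD.pow N) B.nucleus ∧
    (∀ (Γ : C) (Φ Ψ : Γ ⟶ ASD.pow (ASD.pow N)),
      ASD.powMeet Φ Ψ ≫ B.nucleus =
        ASD.powMeet (Φ ≫ B.nucleus) (Ψ ≫ B.nucleus) ≫ B.nucleus) ∧
    (∀ (Γ : C) (Φ Ψ : Γ ⟶ ASD.pow (ASD.pow N)),
      ASD.powJoin Φ Ψ ≫ B.nucleus =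
        ASD.powJoin (Φ ≫ B.nucleus) (Ψ ≫ B.nucleus) ≫ B.nucleus) :=
  ⟨B.nucleus_isNucleus, fun _ => ASD.AbstractBasis.nucleus_powMeet,
    fun _ => ASD.AbstractBasis.nucleus_powJoin⟩
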